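/- Let $m_1\ge m_2\ge 2$ and $q\ge 2$ be integers, $\mathcal A_i=\{0,\dots,m_i-1\}$, $\Sigma=(\mathcal A_1\times\mathcal A_2)^{\mathbb N^*}$, $\Sigma_2=\mathcal A_2^{\mathbb N^*}$, and let $\pi:\Sigma\to\Sigma_2$, $\pi((x_k,y_k)_k)=(y_k)_k$. For a finite word $u$, $[u]$ denotes the cylinder of all sequences that begin with $u$. Put $\gamma=\log m_2/\log m_1$. Equip $\Sigma_2$ with the metric $d_2(y,v)=m_1^{-\gamma\min\{k\ge0:\,y_{k+1}\ne v_{k+1}\}}$ and $\Sigma$ with $$d\big((x,y),(u,v)\big)=\max\Big(m_1^{-\min\{k\ge 0:\,(x_{k+1},y_{k+1})\neq(u_{k+1},v_{k+1})\}},\ d_2(y,v)\Big)$$ (a term is $0$ when the two sequences it compares coincide). A Borel probability measure $\nu$ on such a space is *exact dimensional* if there is $\delta\in\mathbb R$ with $\lim_{r\to0^+}\log\nu(B(z,r))/\log r=\delta$ for $\nu$-a.e. $z$, where $B(z,r)$ is the closed ball. The *entropy dimension* of $\nu$ is, when the limit exists, $\dim_e(\nu)=\lim_{n\to\infty}-\frac1n\sum_u\nu([u])\log\nu([u])$,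 the sum being over all words $u$ of length $n$. For a Borel probability measure $\nu$ on $\Sigma$, let $(\nu^y)_{y\in\Sigma_2}$ be its ($\pi_*\nu$-a.e. unique) disintegration with respect to $\pi$. Let $\Omega\subset\Sigma$ be closed and let $\mu$ be a Borel probability measure on $\Omega$. Let $\mathbb P_\mu$ be the Borel probability measure on $\Sigma$ with $$\mathbb P_\mu([z_1\cdots z_n])=\prod_{1\le i\le n,\ q\nmid i}\mu\big([z_i z_{qi}\cdots z_{q^{r}i}]\big),\qquad q^{r}i\le n<q^{r+1}i,$$ for all $n$ and all $z_1,\dots,z_n\in\mathcal A_1\times\mathcal A_2$ (with $r=r(i,n)$). **Proposition (Ledrappier–Young inequality).** 1. $\pi_*\mathbb P_\mu$ is exact dimensional for $d_2$, and $\mathbb P_\mu^y$ is exact dimensional for $d$ for $\pi_*\mathbb P_\mu$-a.e. $y$. 2. The entropy dimensions of $\mathbb P_\mu$, of $\pi_*\mathbb P_\mu$ and, for $\pi_*\mathbb P_\mu$-a.e. $y$, of $\mathbb P^y_\mu$ exist, and $\dim_e(\mathbb P_\mu^y)$ is $\pi_*\mathbb P_\mu$-a.s. constant: $$\operatorname*{ess\,inf}_{y\sim\pi_*\mathbb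 P_\mu}\dim_e(\mathbb P_\mu^y)=\operatorname*{ess\,sup}_{y\sim\pi_*\mathbb P_\mu}\dim_e(\mathbb P_\mu^y).$$ 3. $$\dim_e(\pi_*\mathbb P_\mu)+\operatorname*{ess\,inf}_{y\sim\pi_*\mathbb P_\mu}\dim_e(\mathbb P_\mu^y)\le\dim_e(\mathbb P_\mu).$$ 4. Equality holds in 3 if and only if for every $p\ge1$ and every word $u=(x_1,y_1)\cdots(x_p,y_p)$ with $I=\Omega\cap[u]\neq\varnothing$, the map $y\mapsto\mu^y(I)$ is $\pi_*\mu$-a.s. constant on the cylinder $\pi([u])=[y_1\cdots y_p]$ of $\Sigma_2$. -/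

import Mathlib

open MeasureTheory ProbabilityTheory Filter Topology

/-! ### Symbolic spaces

A sequence `z : ℕ → A` stands for the sequence `(z_k)_{k ≥ 1}` with `z_k = z (k - 1)`. -/

/-- The cylinder `[u]` of all sequences that start with the word `u` of length `n`. -/
def cyl {A : Type*} {n : ℕ} (u : Fin n → A) : Set (ℕ → A) :=
  {z | ∀ k : Fin n, z k = u k}

/-- The words of length `n` that are prefixes of elements of `Ω`. -/
def Pref {A : Type*} (n : ℕ) (Ω : Set (ℕ → A)) : Set (Fin n → A) :=
  {u | (Ω ∩ cyl u).Nonempty}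

/-- The projection `π` of `(A₁ × A₂)^ℕ` to `A₂^ℕ` (second coordinate). -/
def projY {A₁ A₂ : Type*} (z : ℕ → A₁ × A₂) : ℕ → A₂ := fun k => (z k).2

/-- The exponent `γ = log m₂ / log m₁`. -/
noncomputable def gam (m₁ m₂ : ℕ) : ℝ := Real.log m₂ / Real.log m₁

/-- The metric on `A₂^ℕ`: `m₁ ^ (-γ k)`, with `k ≥ 0` the length of the longest common prefix
(this number is `m₂ ^ (-k)`), and `0` for equal sequences. -/
noncomputable def distY (m₁ m₂ : ℕ) (y v : ℕ → Fin m₂) : ℝ :=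
  open Classical in
  if y = v then 0 else (m₁ : ℝ) ^ (-(gam m₁ m₂ * PiNat.firstDiff y v))

/-- The metric `d` on `(A₁ × A₂)^ℕ`: the maximum of `m₁ ^ (-k)`, with `k` the length of the longest
common prefix of the two sequences, and of the distance of their second coordinates. -/
noncomputable def distXY (m₁ m₂ : ℕ) (z w : ℕ → Fin m₁ × Fin m₂) : ℝ :=
  open Classical in
  max (if z = w then 0 else (m₁ : ℝ) ^ (-(PiNat.firstDiff z w : ℝ)))
    (distY m₁ m₂ (projY z) (projY w))

/-! ### Dimensions of measures -/

/-- `ν` is exact dimensional for the distance `d`: for some `δ`, the local dimension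
`lim_{r → 0} log ν(B(x, r)) / log r` exists and equals `δ` for `ν`-almost every `x`. -/
def IsExactDimensional {X : Type*} [MeasurableSpace X] (d : X → X → ℝ) (ν : Measure X) : Prop :=
  ∃ δ : ℝ, ∀ᵐ x ∂ν,
    Tendsto (fun r : ℝ => Real.log (ν.real {w | d x w ≤ r}) / Real.log r) (𝓝[>] 0) (𝓝 δ)

section Entropy

variable {A : Type*} [Fintype A] [MeasurableSpace A]

/-- `(1/n)` times the `ν`-entropy of the partition into cylinders of length `n`. -/
noncomputable def entropyRate (ν : Measure (ℕ → A)) (n : ℕ) : ℝ :=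
  -(1 / (n : ℝ)) * ∑ u : Fin n → A, ν.real (cyl u) * Real.log (ν.real (cyl u))

/-- The entropy dimension of `ν` exists and equals `δ`. -/
def HasEntropyDim (ν : Measure (ℕ → A)) (δ : ℝ) : Prop :=
  Tendsto (entropyRate ν) atTop (𝓝 δ)

/-- The entropy dimension `dim_e ν` (meaningful when `HasEntropyDim ν δ` for some `δ`). -/
noncomputable def dimE (ν : Measure (ℕ → A)) : ℝ := limUnder atTop (entropyRate ν)

end Entropy

/-- The disintegration `(ν^y)_y` of `ν` along the second coordinate: the regular conditional
distribution under `ν` of the point `z`, given `π z = y`. -/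
noncomputable def disint {m₁ m₂ : ℕ} [NeZero m₁] [NeZero m₂]
    (ν : Measure (ℕ → Fin m₁ × Fin m₂)) [IsFiniteMeasure ν] :
    Kernel (ℕ → Fin m₂) (ℕ → Fin m₁ × Fin m₂) :=
  condDistrib id projY ν

/-! ### The multiplicative product measure -/

/-- The sequence `z` with `z_{i q ^ r} = (r + 1)`-st letter of `ω i`, for all `i ≥ 1` with `q ∤ i`
and all `r ≥ 0`: write a position `k + 1` as `i q ^ r` with `r` maximal. -/
noncomputable def assemble {A : Type*} (q : ℕ) (ω : ℕ → ℕ → A) : ℕ → A :=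
  fun k => ω ((k + 1) / q ^ multiplicity q (k + 1)) (multiplicity q (k + 1))

/-- The measure `ℙ_μ`: the law of the sequence whose restrictions to the sets
`J_i = {i, i q, i q ^ 2, …}`, `q ∤ i`, are independent with law `μ`. -/
noncomputable def Pmu {A : Type*} [MeasurableSpace A] (q : ℕ) (μ : Measure (ℕ → A)) :
    Measure (ℕ → A) :=
  (Measure.infinitePi fun _ : ℕ => μ).map (assemble q)

theorem assemble_apply {A : Type*} {q : ℕ} (hq : 2 ≤ q) (ω : ℕ → ℕ → A) {i : ℕ} (hi : ¬ q ∣ i)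
    (r : ℕ) : assemble q ω (i * q ^ r - 1) = ω i r := by
  have hi0 : 0 < i := Nat.pos_of_ne_zero (by rintro rfl; exact hi (dvd_zero q))
  have hqr : 0 < q ^ r := Nat.pow_pos (by omega)
  have hpos : 0 < i * q ^ r := Nat.mul_pos hi0 hqr
  have h1 : i * q ^ r - 1 + 1 = i * q ^ r := by omega
  have hm : multiplicity q (i * q ^ r) = r := by
    apply multiplicity_eq_of_dvd_of_not_dvd (Dvd.intro_left i rfl)
    rw [pow_succ, mul_comm i]
    intro h
    exact hi (Nat.dvd_of_mul_dvd_mul_left hqr h)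
  simp only [assemble, h1, hm, Nat.mul_div_cancel _ hqr]

theorem exists_position {q : ℕ} (hq : 2 ≤ q) (k : ℕ) :
    ∃ i r, ¬ q ∣ i ∧ 1 ≤ i ∧ i ≤ k + 1 ∧ k = i * q ^ r - 1 ∧ i * q ^ r ≤ k + 1 := by
  have hf : FiniteMultiplicity q (k + 1) := Nat.finiteMultiplicity_iff.2 ⟨by omega, by omega⟩
  obtain ⟨c, hc, hnd⟩ := hf.exists_eq_pow_mul_and_not_dvd
  have hqr : 0 < q ^ multiplicity q (k + 1) := Nat.pow_pos (by omega)
  have hc0 : 0 < c := Nat.pos_of_ne_zero (by rintro rfl; exact hnd (dvd_zero q))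
  have hle : c ≤ k + 1 := by
    conv_rhs => rw [hc]
    exact Nat.le_mul_of_pos_left c hqr
  refine ⟨c, multiplicity q (k + 1), hnd, hc0, hle, ?_, ?_⟩ <;> rw [mul_comm c, ← hc] <;> omega

theorem measurable_assemble {A : Type*} [MeasurableSpace A] (q : ℕ) :
    Measurable (assemble q : (ℕ → ℕ → A) → ℕ → A) := by
  refine measurable_pi_lambda _ fun k => ?_
  exact (measurable_pi_apply _).comp (measurable_pi_apply _)

instance {A : Type*} [MeasurableSpace A] (q : ℕ) (μ : Measure (ℕ → A)) [IsProbabilityMeasure μ] :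
    IsProbabilityMeasure (Pmu q μ) :=
  Measure.isProbabilityMeasure_map (measurable_assemble q).aemeasurable

/-- The values of `ℙ_μ` on cylinders, which determine `ℙ_μ`: the mass of `[z_1 ⋯ z_n]` is the
product over `i ≤ n`, `q ∤ i`, of the `μ`-masses of the cylinders
`[z_i z_{iq} ⋯ z_{i q ^ r}]`, `i q ^ r ≤ n < i q ^ (r + 1)`. -/
theorem Pmu_cyl {A : Type*} [MeasurableSpace A] [MeasurableSingletonClass A] {q : ℕ} (hq : 2 ≤ q)
    (μ : Measure (ℕ → A)) [IsProbabilityMeasure μ] (z : ℕ → A) (n : ℕ) :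
    Pmu q μ (cyl fun k : Fin n => z k) =
      ∏ i ∈ (Finset.Icc 1 n).filter (fun i => ¬ q ∣ i),
        μ {w | ∀ r, i * q ^ r ≤ n → w r = z (i * q ^ r - 1)} := by
  have hmeas : MeasurableSet (cyl fun k : Fin n => z k) := by
    simp only [cyl, Set.ofPred_forall]
    exact MeasurableSet.iInter fun k => (measurable_pi_apply _) (measurableSet_singleton _)
  rw [Pmu, Measure.map_apply (measurable_assemble q) hmeas]
  rw [← Measure.infinitePi_pi (fun _ : ℕ => μ)]
  · congr 1
    ext ω
    simp only [cyl, Set.mem_preimage, Set.mem_ofPred_eq, Set.mem_pi, Finset.coe_filter,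
      Finset.mem_Icc]
    constructor
    · rintro h i ⟨⟨hi1, -⟩, hi⟩ r hr
      have hpos : 0 < i * q ^ r := Nat.mul_pos hi1 (Nat.pow_pos (by omega))
      have := h ⟨i * q ^ r - 1, by omega⟩
      simpa only [assemble_apply hq ω hi r] using this
    · intro h k
      obtain ⟨i, r, hi, hi1, hik, hk, hkr⟩ := exists_position hq (k : ℕ)
      have hkn := k.2
      rw [hk, assemble_apply hq ω hi r]
      exact h i ⟨⟨hi1, by omega⟩, hi⟩ r (by omega)
  · intro i _
    simp only [Set.ofPred_forall]
    exact MeasurableSet.iInter fun r => MeasurableSet.iInter fun _ =>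
      (measurable_pi_apply _) (measurableSet_singleton _)

/-!
# The Ledrappier-Young inequality for the measures `ℙ_μ`

Under `ℙ_μ` the sections of a sequence along the progressions `i, iq, iq², …`, `q ∤ i`, are
independent with law `μ`, and its first `n` letters amount to the first `len q n i` letters of the
sections with `i ≤ n` (`assemble_preimage_cyl`). The `ℙ_μ`-information of a cylinder of length `n`
is therefore a sum of `μ`-informations, and so are the entropies (`info_prodLaw`,
`cylEnt_prodLaw`). As the length `k` occurs about `n (1 - 1/q)² q^(-(k-1))` times among the
`len q n i`, the entropy dimension of `ℙ_μ` is the weighted sum `lam q` of the entropies `H_k(μ)` of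
the partitions into cylinders of length `k` (`tendsto_sum_len`).

The projection of `ℙ_μ` is the measure `ℙ` of the projection of `μ`, and the conditional measure
`ℙ_μ^y` again has independent sections, the `i`-th one with the conditional law of `μ` given the
`i`-th section of `y` (`disint_Pmu`). For almost every `y` these laws are an independent sample, so
that a strong law of large numbers along the progressions (`ae_tendsto_sum_len`) applies to the
entropies and to the information of `ℙ_μ^y`. Its proof is elementary: the sums have variance
`O(n)`, hence converge along the squares, and they are monotone in `n`. The almost sure limit is
`lam q` applied to the mean conditional entropies `∫ H_k(μ^y)`. Since the balls of the metrics are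
cylinders, up to the second coordinates which are constant on a fibre, almost sure convergence of
the information is exact dimensionality.

Finally `H_k(π_*μ) + ∫ H_k(μ^y) ≤ H_k(μ)` for every `k`, by Jensen's inequality for `-t log t`
(`integral_negMulLog_disint_le`); by strict concavity, equality holds for `k` exactly if each
conditional probability `μ^y([u])`, `u` of length `k`, is almost surely constant on the cylinder
`π [u]`. All the weights in `lam q` are positive, so equality of the weighted sums means equality
for all `k`.
-/

/-! ### Counting along the geometric progressions -/

/-- The number of terms `i q ^ r ≤ n`, for `1 ≤ i ≤ n`. -/
def len (q n i : ℕ) : ℕ := Nat.log q (n / i) + 1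

/-- The first terms `i ≤ n` of the progressions `i, i q, i q ^ 2, …` that partition the positive
integers. -/
def idx (q n : ℕ) : Finset ℕ := (Finset.Icc 1 n).filter (fun i => ¬ q ∣ i)

/-- The limit of `(1/n) ∑ e (len q n i)`, the sum being over `i ∈ idx q n`: the length `k + 1`
occurs about `n (1 - 1/q) ^ 2 q ^ (-k)` times. -/
noncomputable def lam (q : ℕ) (e : ℕ → ℝ) : ℝ :=
  (1 - 1 / (q : ℝ)) ^ 2 * ∑' k, e (k + 1) * (1 / (q : ℝ)) ^ k

theorem lt_len_iff {q n i r : ℕ} (hq : 2 ≤ q) (hi : 1 ≤ i) (hin : i ≤ n) :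
    r < len q n i ↔ i * q ^ r ≤ n := by
  have h : n / i ≠ 0 := (Nat.div_pos hin hi).ne'
  rw [len, Nat.lt_succ_iff, Nat.le_log_iff_pow_le (by omega) h, Nat.le_div_iff_mul_le hi, mul_comm]

theorem len_mono {q i n n' : ℕ} (h : n ≤ n') : len q n i ≤ len q n' i :=
  Nat.add_le_add_right (Nat.log_mono_right (Nat.div_le_div_right h)) 1

theorem mem_idx {q n i : ℕ} : i ∈ idx q n ↔ (1 ≤ i ∧ i ≤ n) ∧ ¬ q ∣ i := by
  simp [idx]

theorem idx_mono (q : ℕ) {n n' : ℕ} (h : n ≤ n') : idx q n ⊆ idx q n' := by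
  intro i
  simp only [mem_idx]
  exact fun hi => ⟨⟨hi.1.1, hi.1.2.trans h⟩, hi.2⟩

theorem card_idx (q n : ℕ) : ((idx q n).card : ℝ) = (n : ℝ) - (n / q : ℕ) := by
  have h1 := Finset.card_filter_add_card_filter_not (s := Finset.Ioc 0 n) (fun i => q ∣ i)
  rw [Nat.Ioc_filter_dvd_card_eq_div, Nat.card_Ioc] at h1
  have h2 : idx q n = (Finset.Ioc 0 n).filter (fun i => ¬ q ∣ i) := by
    ext i; simp [mem_idx, Nat.lt_iff_add_one_le]
  rw [h2, eq_sub_iff_add_eq]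
  exact_mod_cast (by omega)

theorem sum_len_eq {q n : ℕ} (hq : 2 ≤ q) (e : ℕ → ℝ) (he : e 0 = 0) :
    ∑ i ∈ idx q n, e (len q n i) =
      ∑ r ∈ Finset.range n, (e (r + 1) - e r) * ((idx q (n / q ^ r)).card : ℝ) := by
  have h1 : ∀ i ∈ idx q n, e (len q n i) =
      ∑ r ∈ Finset.range n, if i * q ^ r ≤ n then e (r + 1) - e r else 0 := by
    intro i hi
    obtain ⟨⟨hi1, hin⟩, -⟩ := mem_idx.1 hi
    rw [← Finset.sum_filter]
    have : (Finset.range n).filter (fun r => i * q ^ r ≤ n) = Finset.range (len q n i) := by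
      ext r
      simp only [Finset.mem_filter, Finset.mem_range, lt_len_iff hq hi1 hin, and_iff_right_iff_imp]
      intro h
      calc r < q ^ r := Nat.lt_pow_self (by omega)
        _ ≤ i * q ^ r := Nat.le_mul_of_pos_left _ hi1
        _ ≤ n := h
    rw [this, Finset.sum_range_sub, he, sub_zero]
  rw [Finset.sum_congr rfl h1, Finset.sum_comm]
  refine Finset.sum_congr rfl fun r _ => ?_
  rw [← Finset.sum_filter, Finset.sum_const, nsmul_eq_mul, mul_comm]
  congr 3
  have hq0 : 0 < q ^ r := Nat.pow_pos (by omega)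
  ext i
  simp only [Finset.mem_filter, mem_idx, Nat.le_div_iff_mul_le hq0]
  constructor
  · rintro ⟨⟨⟨h1, -⟩, h2⟩, h3⟩; exact ⟨⟨h1, h3⟩, h2⟩
  · rintro ⟨⟨h1, h3⟩, h2⟩; exact ⟨⟨⟨h1, (Nat.le_mul_of_pos_right _ hq0).trans h3⟩, h2⟩, h3⟩

theorem summable_growth {q : ℕ} (hq : 2 ≤ q) {e : ℕ → ℝ} {C : ℝ}
    (hC : ∀ k, |e k| ≤ C * ((k : ℝ) + 1) ^ 4) : Summable fun k => |e k| * (1 / (q : ℝ)) ^ k := by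
  have hq' : (2 : ℝ) ≤ q := by exact_mod_cast hq
  have hr : ‖1 / (q : ℝ)‖ < 1 := by
    rw [Real.norm_of_nonneg (by positivity), div_lt_one (by linarith)]; linarith
  have h : Summable fun k : ℕ => ((k + 1 : ℕ) : ℝ) ^ 4 * (1 / (q : ℝ)) ^ (k + 1) :=
    (summable_nat_add_iff (f := fun k : ℕ => (k : ℝ) ^ 4 * (1 / (q : ℝ)) ^ k) 1).2
      (summable_pow_mul_geometric_of_norm_lt_one 4 hr)
  have hq1 : (q : ℝ) * (1 / (q : ℝ)) = 1 := by
    rw [mul_one_div, div_self (by linarith)]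
  refine Summable.of_nonneg_of_le (fun k => by positivity) (fun k => ?_) (h.mul_left (C * q))
  calc |e k| * (1 / (q : ℝ)) ^ k ≤ (C * ((k : ℝ) + 1) ^ 4) * (1 / (q : ℝ)) ^ k :=
        mul_le_mul_of_nonneg_right (hC k) (by positivity)
    _ = C * ((k : ℝ) + 1) ^ 4 * (1 / (q : ℝ)) ^ k * ((q : ℝ) * (1 / (q : ℝ))) := by
        rw [hq1, mul_one]
    _ = _ := by rw [Nat.cast_add, Nat.cast_one, pow_succ (1 / (q : ℝ)) k]; ring

theorem summable_shift {q : ℕ} (hq : 2 ≤ q) {e : ℕ → ℝ} {C : ℝ}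
    (hC : ∀ k, |e k| ≤ C * ((k : ℝ) + 1) ^ 4) :
    Summable fun k => e (k + 1) * (1 / (q : ℝ)) ^ k := by
  have hq' : (2 : ℝ) ≤ q := by exact_mod_cast hq
  have h := ((summable_nat_add_iff 1).2 (summable_growth hq hC)).mul_left (q : ℝ)
  refine Summable.of_norm (h.congr fun k => ?_)
  rw [norm_mul, Real.norm_eq_abs, norm_pow, Real.norm_of_nonneg (by positivity)]
  rw [pow_succ]
  field_simp

/-- A sum over the progressions is a sum over the exponent `r` of increments of `e`, weighted by the
number of `i ≤ n / q ^ r` with `q ∤ i`; these numbers are asymptotic to `n (1 - 1/q) q ^ (-r)`. -/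
theorem tendsto_sum_len {q : ℕ} (hq : 2 ≤ q) {e : ℕ → ℝ} (he : e 0 = 0) {C : ℝ}
    (hC : ∀ k, |e k| ≤ C * ((k : ℝ) + 1) ^ 4) :
    Tendsto (fun n : ℕ => (∑ i ∈ idx q n, e (len q n i)) / n) atTop (𝓝 (lam q e)) := by
  have hq' : (2 : ℝ) ≤ q := by exact_mod_cast hq
  have hq0 : (0 : ℝ) < q := by linarith
  have hs := summable_growth hq hC
  have hs' := summable_shift hq hC
  have hs0 : Summable fun k => e k * (1 / (q : ℝ)) ^ k := by
    refine Summable.of_norm (hs.congr fun k => ?_)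
    rw [norm_mul, Real.norm_eq_abs, norm_pow, Real.norm_of_nonneg (by positivity)]
  have key : Tendsto (fun n : ℕ => ∑' r, (e (r + 1) - e r) *
      (((idx q (n / q ^ r)).card : ℝ) / n)) atTop
      (𝓝 (∑' r, (e (r + 1) - e r) * ((1 / (q : ℝ)) ^ r - (1 / (q : ℝ)) ^ (r + 1)))) := by
    refine tendsto_tsum_of_dominated_convergence
      (bound := fun r => |(e (r + 1) - e r)| * (1 / (q : ℝ)) ^ r) ?_ ?_ ?_
    · refine ((hs'.sub hs0).abs).congr fun k => ?_
      rw [← sub_mul, abs_mul, abs_of_nonneg (by positivity : (0 : ℝ) ≤ (1 / (q : ℝ)) ^ k)]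
    · intro r
      refine Tendsto.const_mul _ ?_
      have hfl : ∀ r : ℕ, Tendsto (fun n : ℕ => ((n / q ^ r : ℕ) : ℝ) / n) atTop
          (𝓝 ((1 / (q : ℝ)) ^ r)) := by
        intro r
        refine ((tendsto_nat_floor_mul_div_atTop
          (by positivity : (0 : ℝ) ≤ (1 / (q : ℝ)) ^ r)).comp
            tendsto_natCast_atTop_atTop).congr fun n => ?_
        simp only [Function.comp]
        congr 2
        rw [← Nat.floor_div_eq_div (K := ℝ)]
        congr 1
        push_cast
        rw [one_div, inv_pow]; field_simp
      refine ((hfl r).sub (hfl (r + 1))).congr fun n => ?_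
      rw [card_idx, sub_div, Nat.div_div_eq_div_mul, ← pow_succ]
    · refine Eventually.of_forall fun n r => ?_
      rw [norm_mul, Real.norm_eq_abs, Real.norm_of_nonneg (by positivity)]
      refine mul_le_mul_of_nonneg_left ?_ (abs_nonneg _)
      rcases Nat.eq_zero_or_pos n with rfl | hn
      · simp
      · rw [div_le_iff₀ (by exact_mod_cast hn), card_idx]
        have h1 : ((n / q ^ r : ℕ) : ℝ) ≤ n / (q ^ r : ℕ) := Nat.cast_div_le
        have h2 : (0 : ℝ) ≤ ((n / q ^ r / q : ℕ) : ℝ) := Nat.cast_nonneg _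
        have h3 : (n : ℝ) / (q ^ r : ℕ) = (1 / (q : ℝ)) ^ r * n := by
          push_cast; rw [one_div, inv_pow]; field_simp
        linarith
  have hlim : ∑' r, (e (r + 1) - e r) * ((1 / (q : ℝ)) ^ r - (1 / (q : ℝ)) ^ (r + 1)) =
      lam q e := by
    have h0 : ∑' k, e k * (1 / (q : ℝ)) ^ k =
        (1 / (q : ℝ)) * ∑' k, e (k + 1) * (1 / (q : ℝ)) ^ k := by
      rw [hs0.tsum_eq_zero_add, he, zero_mul, zero_add, ← tsum_mul_left]
      exact tsum_congr fun k => by ring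
    have h1 : ∀ r, (e (r + 1) - e r) * ((1 / (q : ℝ)) ^ r - (1 / (q : ℝ)) ^ (r + 1)) =
        (1 - 1 / (q : ℝ)) * (e (r + 1) * (1 / (q : ℝ)) ^ r - e r * (1 / (q : ℝ)) ^ r) :=
      fun r => by ring
    rw [tsum_congr h1, tsum_mul_left, hs'.tsum_sub hs0, h0, lam]
    ring
  rw [← hlim]
  refine key.congr fun n => ?_
  rw [sum_len_eq hq e he, Finset.sum_div, tsum_eq_sum (s := Finset.range n)]
  · exact Finset.sum_congr rfl fun r _ => by ring
  · intro r hr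
    have hnr : n < q ^ r := lt_of_le_of_lt (by simpa using hr) (Nat.lt_pow_self (by omega))
    simp [Nat.div_eq_of_lt hnr, idx]

theorem lam_mono {q : ℕ} (hq : 2 ≤ q) {e e' : ℕ → ℝ} {C : ℝ}
    (hC : ∀ k, |e k| ≤ C * ((k : ℝ) + 1) ^ 4) (hC' : ∀ k, |e' k| ≤ C * ((k : ℝ) + 1) ^ 4)
    (h : ∀ k, e k ≤ e' k) : lam q e ≤ lam q e' := by
  refine mul_le_mul_of_nonneg_left ?_ (sq_nonneg _)
  exact (summable_shift hq hC).tsum_le_tsum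
    (fun k => mul_le_mul_of_nonneg_right (h _) (by positivity)) (summable_shift hq hC')

theorem lam_eq_iff {q : ℕ} (hq : 2 ≤ q) {e e' : ℕ → ℝ} {C : ℝ}
    (hC : ∀ k, |e k| ≤ C * ((k : ℝ) + 1) ^ 4) (hC' : ∀ k, |e' k| ≤ C * ((k : ℝ) + 1) ^ 4)
    (h : ∀ k, e k ≤ e' k) : lam q e = lam q e' ↔ ∀ k, 1 ≤ k → e k = e' k := by
  have hq' : (2 : ℝ) ≤ q := by exact_mod_cast hq
  constructor
  · intro heq k hk
    by_contra hne
    refine absurd heq (ne_of_lt (mul_lt_mul_of_pos_left ?_ (pow_pos ?_ 2)))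
    · refine Summable.tsum_lt_tsum (i := k - 1)
        (fun k => mul_le_mul_of_nonneg_right (h _) (by positivity)) ?_
        (summable_shift hq hC) (summable_shift hq hC')
      rw [Nat.sub_add_cancel hk]
      exact mul_lt_mul_of_pos_right (lt_of_le_of_ne (h k) hne) (by positivity)
    · rw [sub_pos, div_lt_one (by linarith)]; linarith
  · intro heq
    simp only [lam, heq _ (Nat.le_add_left 1 _)]

theorem lam_add {q : ℕ} (hq : 2 ≤ q) {e e' : ℕ → ℝ} {C C' : ℝ}
    (hC : ∀ k, |e k| ≤ C * ((k : ℝ) + 1) ^ 4) (hC' : ∀ k, |e' k| ≤ C' * ((k : ℝ) + 1) ^ 4) :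
    lam q (fun k => e k + e' k) = lam q e + lam q e' := by
  simp only [lam, add_mul]
  rw [(summable_shift hq hC).tsum_add (summable_shift hq hC'), mul_add]

/-! ### A strong law of large numbers along the geometric progressions -/

theorem tendsto_div_of_tendsto_sq {u : ℕ → ℝ} {l : ℝ} (hu : Monotone u)
    (h : Tendsto (fun k : ℕ => u ((k + 1) ^ 2) / ((k + 1) ^ 2 : ℕ)) atTop (𝓝 l)) :
    Tendsto (fun n => u n / n) atTop (𝓝 l) := by
  refine tendsto_div_of_monotone_of_exists_subseq_tendsto_div u l hu fun a ha =>
    ⟨fun k => (k + 1) ^ 2, ?_, ?_, h⟩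
  · obtain ⟨N, hN⟩ := exists_nat_gt (3 / (a - 1))
    refine eventually_atTop.2 ⟨N, fun n hn => ?_⟩
    have hn' : (N : ℝ) ≤ n := by exact_mod_cast hn
    have h1 : 3 < (n : ℝ) * (a - 1) := by
      have := (div_lt_iff₀ (by linarith)).1 (hN.trans_le hn')
      linarith
    push_cast
    nlinarith [Nat.cast_nonneg (α := ℝ) n]
  · exact tendsto_atTop_mono (fun k => by simp only [id]; nlinarith) tendsto_id

/-- The sums have variance `O(n)` by independence, so that they obey the law of large numbers along
the squares by the Borel-Cantelli lemma, and then along the integers by monotonicity. -/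
theorem ae_tendsto_sum_len {Y : Type*} [MeasurableSpace Y] (ρ : Measure Y) [IsProbabilityMeasure ρ]
    {q : ℕ} (hq : 2 ≤ q) (f : ℕ → Y → ℝ) (C : ℝ) (hfm : ∀ k, Measurable (f k))
    (hf : ∀ k, MemLp (f k) 2 ρ) (hC : ∀ k, ∫ y, f k y ^ 2 ∂ρ ≤ C * ((k : ℝ) + 1) ^ 4)
    (hC1 : ∀ k, |∫ y, f k y ∂ρ| ≤ C * ((k : ℝ) + 1) ^ 4)
    (h0 : ∀ y, f 0 y = 0) (hmono : ∀ᵐ y ∂ρ, Monotone fun k => f k y) :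
    ∀ᵐ ω ∂Measure.infinitePi (fun _ : ℕ => ρ),
      Tendsto (fun n : ℕ => (∑ i ∈ idx q n, f (len q n i) (ω i)) / n) atTop
        (𝓝 (lam q fun k => ∫ y, f k y ∂ρ)) := by
  set P := Measure.infinitePi (fun _ : ℕ => ρ) with hP
  have hmp : ∀ i, MeasurePreserving (Function.eval i) P ρ := fun i =>
    measurePreserving_eval_infinitePi (fun _ : ℕ => ρ) i
  set S : ℕ → (ℕ → Y) → ℝ := fun n => ∑ i ∈ idx q n, fun ω => f (len q n i) (ω i) with hS
  have hSa : ∀ n ω, S n ω = ∑ i ∈ idx q n, f (len q n i) (ω i) := fun n ω => by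
    simp [hS, Finset.sum_apply]
  have hL : ∀ k i, MemLp (fun ω : ℕ → Y => f k (ω i)) 2 P := fun k i =>
    (hf k).comp_measurePreserving (hmp i)
  have hint : ∀ k i, ∫ ω, f k (ω i) ∂P = ∫ y, f k y ∂ρ := fun k i => by
    rw [← (hmp i).map_eq, integral_map (measurable_pi_apply i).aemeasurable
      ((hfm k).aestronglyMeasurable)]
  have hint2 : ∀ k i, ∫ ω, f k (ω i) ^ 2 ∂P = ∫ y, f k y ^ 2 ∂ρ := fun k i => by
    rw [← (hmp i).map_eq, integral_map (measurable_pi_apply i).aemeasurable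
      (((hfm k).pow_const 2).aestronglyMeasurable)]
  have hSL : ∀ n, MemLp (S n) 2 P := fun n => memLp_finsetSum' _ fun i _ => hL _ i
  have hES : ∀ n, ∫ ω, S n ω ∂P = ∑ i ∈ idx q n, ∫ y, f (len q n i) y ∂ρ := by
    intro n
    simp only [hSa]
    rw [integral_finsetSum _ fun i _ => (hL _ i).integrable (by norm_num)]
    exact Finset.sum_congr rfl fun i _ => hint _ i
  have hVar : ∀ n, Var[S n; P] ≤ ∑ i ∈ idx q n, ∫ y, f (len q n i) y ^ 2 ∂ρ := by
    intro n
    rw [hS, IndepFun.variance_sum (fun i _ => hL _ i)]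
    · refine Finset.sum_le_sum fun i _ => ?_
      refine (variance_le_expectation_sq (hL _ i).1).trans ?_
      exact (hint2 _ i).le
    · intro i _ j _ hij
      have := iIndepFun_infinitePi (P := fun _ : ℕ => ρ) (X := fun i => f (len q n i))
        (fun i => hfm _)
      exact this.indepFun hij
  have hE : Tendsto (fun n : ℕ => (∫ ω, S n ω ∂P) / n) atTop
      (𝓝 (lam q fun k => ∫ y, f k y ∂ρ)) := by
    simp only [hES]
    exact tendsto_sum_len hq (e := fun k => ∫ y, f k y ∂ρ) (by simp [h0]) hC1
  obtain ⟨V, hV⟩ : ∃ V : ℝ, ∀ n : ℕ, Var[S n; P] ≤ V * n := by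
    have ht : Tendsto (fun n : ℕ => (∑ i ∈ idx q n, ∫ y, f (len q n i) y ^ 2 ∂ρ) / n) atTop _ :=
      tendsto_sum_len hq (e := fun k => ∫ y, f k y ^ 2 ∂ρ) (by simp [h0]) fun k => by
        rw [abs_of_nonneg (integral_nonneg fun y => sq_nonneg _)]; exact hC k
    obtain ⟨V, hV⟩ := ht.bddAbove_range
    refine ⟨V, fun n => (hVar n).trans ?_⟩
    rcases Nat.eq_zero_or_pos n with rfl | hn
    · simp [idx]
    · rw [← div_le_iff₀ (by exact_mod_cast hn)]
      exact hV ⟨n, rfl⟩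
  have hBC : ∀ m : ℕ, ∀ᵐ ω ∂P, ∀ᶠ k : ℕ in atTop,
      |S ((k + 1) ^ 2) ω - ∫ ω', S ((k + 1) ^ 2) ω' ∂P| <
        (k + 1 : ℝ) ^ 2 * (1 / ((m : ℝ) + 1)) := by
    intro m
    have hsum : Summable fun k : ℕ => V * ((m : ℝ) + 1) ^ 2 * (1 / ((k : ℝ) + 1) ^ 2) := by
      have := (summable_nat_add_iff 1).2 (Real.summable_one_div_nat_pow.2 (by norm_num : 1 < 2))
      exact (this.mul_left _).congr fun k => by push_cast; rfl
    have hle : ∀ k : ℕ, P {ω | (k + 1 : ℝ) ^ 2 * (1 / ((m : ℝ) + 1)) ≤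
        |S ((k + 1) ^ 2) ω - ∫ ω', S ((k + 1) ^ 2) ω' ∂P|} ≤
        ENNReal.ofReal (V * ((m : ℝ) + 1) ^ 2 * (1 / ((k : ℝ) + 1) ^ 2)) := by
      intro k
      refine (meas_ge_le_variance_div_sq (hSL _) (by positivity)).trans
        (ENNReal.ofReal_le_ofReal ?_)
      rw [div_le_iff₀ (by positivity)]
      refine (hV _).trans (le_of_eq ?_)
      push_cast
      field_simp
    have hfin : ∑' k : ℕ, P {ω | (k + 1 : ℝ) ^ 2 * (1 / ((m : ℝ) + 1)) ≤
        |S ((k + 1) ^ 2) ω - ∫ ω', S ((k + 1) ^ 2) ω' ∂P|} ≠ ⊤ :=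
      ne_top_of_le_ne_top hsum.tsum_ofReal_ne_top (ENNReal.tsum_le_tsum hle)
    filter_upwards [ae_eventually_notMem hfin] with ω hω
    filter_upwards [hω] with k hk
    exact not_le.1 hk
  have hmonoω : ∀ᵐ ω ∂P, ∀ i, Monotone fun k => f k (ω i) :=
    ae_all_iff.2 fun i => (hmp i).quasiMeasurePreserving.ae hmono
  filter_upwards [ae_all_iff.2 hBC, hmonoω] with ω hω hm
  have hSm : Monotone fun n => S n ω := by
    intro n n' hn
    simp only [hSa]
    calc ∑ i ∈ idx q n, f (len q n i) (ω i) ≤ ∑ i ∈ idx q n, f (len q n' i) (ω i) :=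
          Finset.sum_le_sum fun i _ => hm i (len_mono hn)
      _ ≤ _ := Finset.sum_le_sum_of_subset_of_nonneg (idx_mono q hn) fun i _ _ => by
          rw [← h0 (ω i)]; exact hm i (Nat.zero_le _)
  simp only [← hSa]
  refine tendsto_div_of_tendsto_sq hSm ?_
  have hsq : Tendsto (fun k : ℕ => (k + 1) ^ 2) atTop atTop :=
    tendsto_atTop_mono (fun k => by simp only [id]; nlinarith) tendsto_id
  have hE2 := hE.comp hsq
  have hdiff : Tendsto (fun k : ℕ => (S ((k + 1) ^ 2) ω - ∫ ω', S ((k + 1) ^ 2) ω' ∂P) /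
      ((k + 1) ^ 2 : ℕ)) atTop (𝓝 0) := by
    rw [Metric.tendsto_atTop']
    intro ε hε
    obtain ⟨m, hm⟩ := exists_nat_one_div_lt hε
    obtain ⟨N, hN⟩ := eventually_atTop.1 (hω m)
    refine ⟨N, fun k hk => ?_⟩
    have h1 := hN k hk.le
    have hpos : (0 : ℝ) < ((k : ℝ) + 1) ^ 2 := by positivity
    rw [Real.dist_eq, sub_zero, abs_div, Nat.abs_cast, div_lt_iff₀ (by push_cast; exact hpos)]
    push_cast
    nlinarith
  have := hdiff.add hE2
  rw [zero_add] at this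
  refine this.congr fun k => ?_
  simp only [Function.comp]
  ring

/-! ### Entropy and information of cylinders -/

/-- The prefix of length `k` of a sequence. -/
def pre {A : Type*} (k : ℕ) (z : ℕ → A) : Fin k → A := fun j => z j

theorem mem_cyl {A : Type*} {k : ℕ} {u : Fin k → A} {z : ℕ → A} : z ∈ cyl u ↔ pre k z = u := by
  simp [cyl, pre, funext_iff]

theorem cyl_eq_preimage {A : Type*} {k : ℕ} (u : Fin k → A) : cyl u = pre k ⁻¹' {u} := by
  ext z; simp [mem_cyl]

theorem self_mem_cyl {A : Type*} (k : ℕ) (z : ℕ → A) : z ∈ cyl (pre k z) := mem_cyl.2 rfl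

theorem exists_pre_eq {A : Type*} [Nonempty A] {k : ℕ} (u : Fin k → A) : ∃ z, pre k z = u := by
  inhabit A
  exact ⟨fun j => if h : j < k then u ⟨j, h⟩ else default, by ext j; simp [pre]⟩

theorem cyl_pre_anti {A : Type*} (z : ℕ → A) : Antitone fun k => cyl (pre k z) := by
  intro k k' h w hw j
  exact hw ⟨j, j.2.trans_le h⟩

theorem cyl_pre_zero {A : Type*} (u : Fin 0 → A) : cyl u = Set.univ := by
  ext z; simp [cyl]

theorem measurable_pre {A : Type*} [MeasurableSpace A] (k : ℕ) :
    Measurable (pre k : (ℕ → A) → Fin k → A) :=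
  measurable_pi_lambda _ fun _ => measurable_pi_apply _

theorem measurableSet_cyl {A : Type*} [MeasurableSpace A] [MeasurableSingletonClass A] {k : ℕ}
    (u : Fin k → A) : MeasurableSet (cyl u) := by
  rw [cyl_eq_preimage]
  exact measurable_pre k (measurableSet_singleton u)

/-- The information `-log ν([z_1 ⋯ z_k])`. -/
noncomputable def info {A : Type*} [MeasurableSpace A] (ν : Measure (ℕ → A)) (k : ℕ) (z : ℕ → A) :
    ℝ := -Real.log (ν.real (cyl (pre k z)))

/-- The entropy of the partition into cylinders of length `k`. -/
noncomputable def cylEnt {A : Type*} [Fintype A] [MeasurableSpace A] (ν : Measure (ℕ → A)) (k : ℕ) :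
    ℝ := ∑ u : Fin k → A, Real.negMulLog (ν.real (cyl u))

theorem entropyRate_eq {A : Type*} [Fintype A] [MeasurableSpace A] (ν : Measure (ℕ → A)) (n : ℕ) :
    entropyRate ν n = cylEnt ν n / n := by
  simp only [entropyRate, cylEnt, Real.negMulLog, neg_mul, Finset.sum_neg_distrib]
  ring

/-- The second moment of the information of cylinders of length `k` over the alphabet `A`, and their
entropy, are at most `entBound A * (k + 1) ^ 2`, whatever the measure. -/
noncomputable def entBound (A : Type*) [Fintype A] : ℝ :=
  4 * Real.log (Fintype.card A) ^ 2 + 17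

/-- Summed over the `N` atoms of a partition, this bounds the second moment of the information by
`4 (log N) ^ 2 + 16`. Atoms of mass at least `N ^ (-2)` account for the first term. -/
theorem mul_log_sq_le {p N : ℝ} (hp0 : 0 ≤ p) (hp1 : p ≤ 1) (hN : 1 ≤ N) :
    p * Real.log p ^ 2 ≤ 4 * Real.log N ^ 2 * p + 16 / N := by
  have hN0 : 0 < N := by linarith
  rcases hp0.eq_or_lt with rfl | hp
  · simp; positivity
  have hlN : 0 ≤ Real.log N := Real.log_nonneg hN
  have hlp : Real.log p ≤ 0 := Real.log_nonpos hp0 hp1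
  rcases le_or_gt 1 (p * N ^ 2) with h | h
  · have h1 : 0 ≤ Real.log (p * N ^ 2) := Real.log_nonneg h
    rw [Real.log_mul hp.ne' (by positivity), Real.log_pow] at h1
    push_cast at h1
    have h2 : Real.log p ^ 2 ≤ 4 * Real.log N ^ 2 := by nlinarith
    have h3 : 0 ≤ 16 / N := by positivity
    nlinarith [mul_le_mul_of_nonneg_left h2 hp0]
  -- Here `p (log p) ^ 2 = √p (p ^ (1/4) log p) ^ 2 ≤ 16 √p` and `√p ≤ 1 / N`.
  · have h1 := Real.abs_log_mul_self_rpow_lt p (1 / 4) hp hp1 (by norm_num)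
    have h2 : (Real.log p * p ^ (1 / 4 : ℝ)) ^ 2 ≤ 16 := by
      rw [← sq_abs]
      have : (4 : ℝ) = 1 / (1 / 4) := by norm_num
      rw [← this] at h1
      nlinarith [abs_nonneg (Real.log p * p ^ (1 / 4 : ℝ))]
    have h3 : (p ^ (1 / 4 : ℝ)) ^ 2 = √p := by
      rw [Real.sqrt_eq_rpow, ← Real.rpow_natCast, ← Real.rpow_mul hp0]; norm_num
    rw [mul_pow, h3] at h2
    have h4 : √p ≤ 1 / N := by
      rw [Real.sqrt_le_left (by positivity), div_pow, one_pow, le_div_iff₀ (by positivity)]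
      exact h.le
    have h5 : p * Real.log p ^ 2 = √p * (Real.log p ^ 2 * √p) := by
      nth_rewrite 1 [← Real.mul_self_sqrt hp0]; ring
    have h6 : 0 ≤ 4 * Real.log N ^ 2 * p := by positivity
    calc p * Real.log p ^ 2 = √p * (Real.log p ^ 2 * √p) := h5
      _ ≤ (1 / N) * 16 := by gcongr
      _ ≤ _ := by rw [one_div_mul_eq_div]; linarith

theorem cylEnt_nonneg {A : Type*} [Fintype A] [MeasurableSpace A] (ν : Measure (ℕ → A))
    [IsProbabilityMeasure ν] (k : ℕ) : 0 ≤ cylEnt ν k :=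
  Finset.sum_nonneg fun _ _ => Real.negMulLog_nonneg measureReal_nonneg measureReal_le_one

theorem info_zero {A : Type*} [MeasurableSpace A] (ν : Measure (ℕ → A))
    [IsProbabilityMeasure ν] (z : ℕ → A) : info ν 0 z = 0 := by
  simp [info, cyl_pre_zero]

theorem cylEnt_zero {A : Type*} [Fintype A] [MeasurableSpace A] (ν : Measure (ℕ → A))
    [IsProbabilityMeasure ν] : cylEnt ν 0 = 0 := by
  simp [cylEnt, cyl_pre_zero]

/-- Outside of a null set the logarithms in `info` have their usual meaning. -/
theorem ae_cyl_pos {A : Type*} [Fintype A] [MeasurableSpace A] (ν : Measure (ℕ → A))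
    [IsFiniteMeasure ν] :
    ∀ᵐ z ∂ν, ∀ k, 0 < ν.real (cyl (pre k z)) := by
  refine ae_all_iff.2 fun k => ?_
  have h : ∀ u : Fin k → A, ∀ᵐ z ∂ν, pre k z = u → 0 < ν.real (cyl u) := by
    intro u
    by_cases hu : ν (cyl u) = 0
    · filter_upwards [measure_eq_zero_iff_ae_notMem.1 hu] with z hz hzu
      exact absurd (mem_cyl.2 hzu) hz
    · exact Eventually.of_forall fun z _ => ENNReal.toReal_pos hu (measure_ne_top _ _)
  filter_upwards [ae_all_iff.2 h] with z hz
  exact hz _ rfl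

theorem measurable_kernel_real {A E : Type*} [MeasurableSpace A] [MeasurableSingletonClass A]
    [MeasurableSpace E] (κ : Kernel E (ℕ → A)) {k : ℕ} (u : Fin k → A) :
    Measurable fun η => (κ η).real (cyl u) :=
  (κ.measurable_coe (measurableSet_cyl u)).ennreal_toReal

theorem ae_monotone_info {A : Type*} [Fintype A] [MeasurableSpace A] (ν : Measure (ℕ → A))
    [IsFiniteMeasure ν] :
    ∀ᵐ z ∂ν, Monotone fun k => info ν k z := by
  filter_upwards [ae_cyl_pos ν] with z hz k k' h
  exact neg_le_neg (Real.log_le_log (hz k') (measureReal_mono (cyl_pre_anti z h)))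

theorem measurableCylinder_eq {A : Type*} [Fintype A] [MeasurableSpace A]
    {t : Set (ℕ → A)} (ht : t ∈ measurableCylinders fun _ : ℕ => A) :
    ∃ (k : ℕ) (S : Set (Fin k → A)), t = pre k ⁻¹' S := by
  obtain ⟨s, S, -, rfl⟩ := (mem_measurableCylinders _).1 ht
  obtain ⟨k, hk⟩ : ∃ k, ∀ i ∈ s, i < k := ⟨s.sup id + 1, fun i hi =>
    Nat.lt_succ_of_le (Finset.le_sup (f := id) hi)⟩
  exact ⟨k, {u | (fun i : s => u ⟨i, hk i i.2⟩) ∈ S}, rfl⟩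

section

variable {A : Type*} [Fintype A] [MeasurableSpace A] [MeasurableSingletonClass A]

theorem integrable_comp_pre (ν : Measure (ℕ → A)) [IsFiniteMeasure ν] (k : ℕ)
    (F : (Fin k → A) → ℝ) : Integrable (fun z => F (pre k z)) ν :=
  (Integrable.of_finite (μ := ν.map (pre k)) (f := F)).comp_measurable (measurable_pre k)

theorem integral_comp_pre (ν : Measure (ℕ → A)) [IsFiniteMeasure ν] (k : ℕ)
    (F : (Fin k → A) → ℝ) : ∫ z, F (pre k z) ∂ν = ∑ u, ν.real (cyl u) * F u := by
  have h := integral_map (μ := ν) (measurable_pre k).aemeasurable (f := F)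
    (measurable_of_finite F).aestronglyMeasurable
  rw [← h, integral_fintype Integrable.of_finite]
  refine Finset.sum_congr rfl fun u _ => ?_
  rw [map_measureReal_apply (measurable_pre k) (measurableSet_singleton u), cyl_eq_preimage,
    smul_eq_mul]

theorem sum_cyl (ν : Measure (ℕ → A)) [IsProbabilityMeasure ν] (k : ℕ) :
    ∑ u : Fin k → A, ν.real (cyl u) = 1 := by
  simpa using (integral_comp_pre ν k fun _ => 1).symm

theorem integral_info (ν : Measure (ℕ → A)) [IsFiniteMeasure ν] (k : ℕ) :
    ∫ z, info ν k z ∂ν = cylEnt ν k := by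
  rw [cylEnt]
  refine (integral_comp_pre ν k fun u => -Real.log (ν.real (cyl u))).trans ?_
  exact Finset.sum_congr rfl fun u _ => by rw [Real.negMulLog]; ring

theorem integrable_info (ν : Measure (ℕ → A)) [IsFiniteMeasure ν] (k : ℕ) :
    Integrable (info ν k) ν :=
  integrable_comp_pre ν k fun u => -Real.log (ν.real (cyl u))

theorem integrable_info_sq (ν : Measure (ℕ → A)) [IsFiniteMeasure ν] (k : ℕ) :
    Integrable (fun z => info ν k z ^ 2) ν :=
  integrable_comp_pre ν k fun u => (-Real.log (ν.real (cyl u))) ^ 2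

theorem integral_info_sq_le [Nonempty A] (ν : Measure (ℕ → A)) [IsProbabilityMeasure ν] (k : ℕ) :
    ∫ z, info ν k z ^ 2 ∂ν ≤ entBound A * ((k : ℝ) + 1) ^ 2 := by
  refine (integral_comp_pre ν k fun u => (-Real.log (ν.real (cyl u))) ^ 2).trans_le ?_
  set N : ℝ := (Fintype.card A : ℝ) ^ k with hN
  have hA : (1 : ℝ) ≤ Fintype.card A := by exact_mod_cast Fintype.card_pos
  have hN1 : 1 ≤ N := one_le_pow₀ hA
  calc ∑ u : Fin k → A, ν.real (cyl u) * (-Real.log (ν.real (cyl u))) ^ 2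
      ≤ ∑ u : Fin k → A, (4 * Real.log N ^ 2 * ν.real (cyl u) + 16 / N) := by
        refine Finset.sum_le_sum fun u _ => ?_
        rw [neg_sq]
        exact mul_log_sq_le measureReal_nonneg measureReal_le_one hN1
    _ = 4 * Real.log N ^ 2 + 16 := by
        rw [Finset.sum_add_distrib, ← Finset.mul_sum, sum_cyl, mul_one, Finset.sum_const,
          Finset.card_univ, Fintype.card_fun, Fintype.card_fin, nsmul_eq_mul]
        push_cast
        rw [← hN, mul_div_cancel₀ _ (by linarith)]
    _ ≤ _ := by
        rw [hN, Real.log_pow, entBound]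
        have hk : (0 : ℝ) ≤ k := Nat.cast_nonneg k
        nlinarith [mul_nonneg hk (sq_nonneg (Real.log (Fintype.card A : ℝ))),
          sq_nonneg (Real.log (Fintype.card A : ℝ))]

theorem cylEnt_sq_le [Nonempty A] (ν : Measure (ℕ → A)) [IsProbabilityMeasure ν] (k : ℕ) :
    cylEnt ν k ^ 2 ≤ entBound A * ((k : ℝ) + 1) ^ 2 := by
  refine le_trans ?_ (integral_info_sq_le ν k)
  have hm : MemLp (info ν k) 2 ν :=
    (memLp_two_iff_integrable_sq (integrable_info ν k).1).2 (integrable_info_sq ν k)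
  have h := variance_nonneg (info ν k) ν
  rw [variance_eq_sub hm, integral_info] at h
  simpa using h

theorem one_le_entBound (A : Type*) [Fintype A] : 1 ≤ entBound A := by
  rw [entBound]; nlinarith [sq_nonneg (Real.log (Fintype.card A : ℝ))]

theorem cylEnt_le [Nonempty A] (ν : Measure (ℕ → A)) [IsProbabilityMeasure ν] (k : ℕ) :
    cylEnt ν k ≤ entBound A * ((k : ℝ) + 1) ^ 2 := by
  have h1 := cylEnt_sq_le ν k
  have h2 : 1 ≤ entBound A * ((k : ℝ) + 1) ^ 2 :=
    one_le_mul_of_one_le_of_one_le (one_le_entBound A)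
      (one_le_pow₀ (by linarith [Nat.cast_nonneg (α := ℝ) k]))
  nlinarith [cylEnt_nonneg ν k]

theorem sq_le_pow_four (k : ℕ) : ((k : ℝ) + 1) ^ 2 ≤ ((k : ℝ) + 1) ^ 4 :=
  pow_le_pow_right₀ (by linarith [Nat.cast_nonneg (α := ℝ) k]) (by norm_num)

theorem abs_cylEnt_le [Nonempty A] (ν : Measure (ℕ → A)) [IsProbabilityMeasure ν] (k : ℕ) :
    |cylEnt ν k| ≤ entBound A * ((k : ℝ) + 1) ^ 4 := by
  rw [abs_of_nonneg (cylEnt_nonneg ν k)]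
  refine (cylEnt_le ν k).trans ?_
  exact mul_le_mul_of_nonneg_left (sq_le_pow_four k) (by linarith [one_le_entBound A])

theorem monotone_cylEnt (ν : Measure (ℕ → A)) [IsFiniteMeasure ν] : Monotone (cylEnt ν) := by
  intro k k' h
  rw [← integral_info, ← integral_info]
  refine integral_mono_ae (integrable_info ν k) (integrable_info ν k') ?_
  filter_upwards [ae_monotone_info ν] with z hz
  exact hz h

theorem ext_of_cyl {ν ν' : Measure (ℕ → A)} [IsProbabilityMeasure ν] [IsProbabilityMeasure ν']
    (h : ∀ k (u : Fin k → A), ν (cyl u) = ν' (cyl u)) : ν = ν' := by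
  have hr : ∀ k, ν.map (pre k) = ν'.map (pre k) := by
    intro k
    refine Measure.ext_of_singleton fun u => ?_
    rw [Measure.map_apply (measurable_pre k) (measurableSet_singleton u),
      Measure.map_apply (measurable_pre k) (measurableSet_singleton u), ← cyl_eq_preimage, h]
  refine ext_of_generate_finite (measurableCylinders fun _ : ℕ => A)
    generateFrom_measurableCylinders.symm isPiSystem_measurableCylinders ?_ (by simp)
  intro t ht
  obtain ⟨k, S, rfl⟩ := measurableCylinder_eq ht
  rw [← Measure.map_apply (measurable_pre k) (Set.toFinite _).measurableSet,
    ← Measure.map_apply (measurable_pre k) (Set.toFinite _).measurableSet, hr]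

end

/-! ### Conditional information along a kernel -/

section

variable {A E : Type*} [Fintype A] [MeasurableSpace A] [MeasurableSingletonClass A]
  [MeasurableSpace E] (κ : Kernel E (ℕ → A)) [IsMarkovKernel κ]

theorem measurable_info_kernel (κ : Kernel E (ℕ → A)) (k : ℕ) :
    Measurable fun p : E × (ℕ → A) => info (κ p.1) k p.2 := by
  have h : Measurable fun p : E × (Fin k → A) => -Real.log ((κ p.1).real (cyl p.2)) :=
    measurable_from_prod_countable_left fun u => (measurable_kernel_real κ u).log.neg
  exact h.comp (measurable_fst.prodMk ((measurable_pre k).comp measurable_snd))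

theorem measurable_cylEnt_kernel (κ : Kernel E (ℕ → A)) (k : ℕ) :
    Measurable fun η => cylEnt (κ η) k :=
  Finset.measurable_sum _ fun u _ => Real.continuous_negMulLog.measurable.comp
    (measurable_kernel_real κ u)

theorem abs_integral_cylEnt_le [Nonempty A] (τ : Measure E) [IsProbabilityMeasure τ] (k : ℕ) :
    |∫ η, cylEnt (κ η) k ∂τ| ≤ entBound A * ((k : ℝ) + 1) ^ 4 := by
  have h := norm_integral_le_of_norm_le_const (μ := τ) (f := fun η => cylEnt (κ η) k)
    (Eventually.of_forall fun η => abs_cylEnt_le (κ η) k)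
  simpa using h

theorem ae_monotone_info_compProd (τ : Measure E) [IsProbabilityMeasure τ] :
    ∀ᵐ p : E × (ℕ → A) ∂(τ ⊗ₘ κ), Monotone fun k => info (κ p.1) k p.2 := by
  refine Measure.ae_compProd_of_ae_ae ?_ (Eventually.of_forall fun η => ae_monotone_info (κ η))
  have : {p : E × (ℕ → A) | Monotone fun k => info (κ p.1) k p.2} =
      ⋂ k, {p | info (κ p.1) k p.2 ≤ info (κ p.1) (k + 1) p.2} := by
    ext p
    simp only [Set.mem_ofPred_eq, Set.mem_iInter]
    exact ⟨fun h k => h (Nat.le_succ k), monotone_nat_of_le_succ⟩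
  rw [this]
  exact MeasurableSet.iInter fun k =>
    measurableSet_le (measurable_info_kernel κ k) (measurable_info_kernel κ (k + 1))

variable [Nonempty A]

theorem integrable_info_sq_compProd (τ : Measure E) [IsProbabilityMeasure τ] (k : ℕ) :
    Integrable (fun p : E × (ℕ → A) => info (κ p.1) k p.2 ^ 2) (τ ⊗ₘ κ) := by
  rw [Measure.integrable_compProd_iff
    ((measurable_info_kernel κ k).pow_const 2).aestronglyMeasurable]
  refine ⟨Eventually.of_forall fun η => integrable_info_sq (κ η) k, ?_⟩
  refine Integrable.of_bound ?_ (entBound A * ((k : ℝ) + 1) ^ 2) (Eventually.of_forall fun η => ?_)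
  · exact (((measurable_info_kernel κ k).pow_const
      2).norm.stronglyMeasurable.integral_kernel_prod_right').aestronglyMeasurable
  · rw [Real.norm_of_nonneg (integral_nonneg fun _ => norm_nonneg _)]
    refine le_trans (le_of_eq ?_) (integral_info_sq_le (κ η) k)
    exact integral_congr_ae (Eventually.of_forall fun z => Real.norm_of_nonneg (sq_nonneg _))

theorem memLp_info_compProd (τ : Measure E) [IsProbabilityMeasure τ] (k : ℕ) :
    MemLp (fun p : E × (ℕ → A) => info (κ p.1) k p.2) 2 (τ ⊗ₘ κ) :=
  (memLp_two_iff_integrable_sq (measurable_info_kernel κ k).aestronglyMeasurable).2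
    (integrable_info_sq_compProd κ τ k)

theorem integral_info_compProd (τ : Measure E) [IsProbabilityMeasure τ] (k : ℕ) :
    ∫ p : E × (ℕ → A), info (κ p.1) k p.2 ∂(τ ⊗ₘ κ) = ∫ η, cylEnt (κ η) k ∂τ := by
  rw [Measure.integral_compProd ((memLp_info_compProd κ τ k).integrable (by norm_num))]
  simp only [integral_info]

theorem integral_info_sq_compProd_le (τ : Measure E) [IsProbabilityMeasure τ] (k : ℕ) :
    ∫ p : E × (ℕ → A), info (κ p.1) k p.2 ^ 2 ∂(τ ⊗ₘ κ) ≤ entBound A * ((k : ℝ) + 1) ^ 2 := by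
  have hi := integrable_info_sq_compProd κ τ k
  rw [Measure.integral_compProd hi]
  calc ∫ η, ∫ z, info (κ η) k z ^ 2 ∂κ η ∂τ ≤ ∫ _, entBound A * ((k : ℝ) + 1) ^ 2 ∂τ :=
        integral_mono hi.integral_compProd (integrable_const _) fun η => integral_info_sq_le (κ η) k
    _ = _ := by simp

/-- The law of large numbers for the conditional information `-log κ(Tω)([ω_1 ⋯ ω_k])`, where `κ` is
the conditional law of the sequence `ω` given `T ω`. -/
theorem ae_tendsto_sum_info {q : ℕ} (hq : 2 ≤ q) (ρ : Measure (ℕ → A)) [IsProbabilityMeasure ρ]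
    {T : (ℕ → A) → E} (hT : Measurable T) (hκ : ρ.map T ⊗ₘ κ = ρ.map fun z => (T z, z)) :
    ∀ᵐ ω ∂Measure.infinitePi (fun _ : ℕ => ρ),
      Tendsto (fun n : ℕ => (∑ i ∈ idx q n, info (κ (T (ω i))) (len q n i) (ω i)) / n) atTop
        (𝓝 (lam q fun k => ∫ η, cylEnt (κ η) k ∂ρ.map T)) := by
  have hmT : Measurable fun z : ℕ → A => (T z, z) := hT.prodMk measurable_id
  have : IsProbabilityMeasure (ρ.map T) := Measure.isProbabilityMeasure_map hT.aemeasurable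
  have hmp : MeasurePreserving (fun z : ℕ → A => (T z, z)) ρ (ρ.map T ⊗ₘ κ) := ⟨hmT, hκ.symm⟩
  have hB : 0 ≤ entBound A := by linarith [one_le_entBound A]
  have hE : ∀ k, ∫ z, info (κ (T z)) k z ∂ρ = ∫ η, cylEnt (κ η) k ∂ρ.map T := by
    intro k
    rw [← integral_info_compProd, hκ,
      integral_map hmT.aemeasurable (measurable_info_kernel κ k).aestronglyMeasurable]
  have hm : ∀ k, Measurable fun z => info (κ (T z)) k z := fun k =>
    (measurable_info_kernel κ k).comp hmT
  have hL : ∀ k, MemLp (fun z => info (κ (T z)) k z) 2 ρ := fun k => by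
    have h := (memLp_info_compProd κ (ρ.map T) k).comp_measurePreserving hmp
    exact h
  simp only [← hE]
  refine ae_tendsto_sum_len ρ hq (fun k z => info (κ (T z)) k z) (entBound A)
    hm hL ?_ ?_
    (fun z => info_zero _ _) (hmp.quasiMeasurePreserving.ae (ae_monotone_info_compProd κ _))
  · intro k
    have h := integral_info_sq_compProd_le κ (ρ.map T) k
    rw [hκ, integral_map hmT.aemeasurable
      ((measurable_info_kernel κ k).pow_const 2).aestronglyMeasurable] at h
    exact h.trans (mul_le_mul_of_nonneg_left (sq_le_pow_four k) hB)
  · intro k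
    rw [hE]
    exact abs_integral_cylEnt_le κ _ k

/-- The law of large numbers for the entropies of the measures `κ η`. -/
theorem ae_tendsto_sum_cylEnt {q : ℕ} (hq : 2 ≤ q) (τ : Measure E) [IsProbabilityMeasure τ] :
    ∀ᵐ η ∂Measure.infinitePi (fun _ : ℕ => τ),
      Tendsto (fun n : ℕ => (∑ i ∈ idx q n, cylEnt (κ (η i)) (len q n i)) / n) atTop
        (𝓝 (lam q fun k => ∫ η, cylEnt (κ η) k ∂τ)) := by
  have hB : 0 ≤ entBound A := by linarith [one_le_entBound A]
  have hbd : ∀ k η, cylEnt (κ η) k ^ 2 ≤ entBound A * ((k : ℝ) + 1) ^ 4 := fun k η =>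
    (cylEnt_sq_le (κ η) k).trans (mul_le_mul_of_nonneg_left (sq_le_pow_four k) hB)
  refine ae_tendsto_sum_len τ hq (fun k η => cylEnt (κ η) k) (entBound A)
    (measurable_cylEnt_kernel κ) ?_ ?_ (abs_integral_cylEnt_le κ τ)
    (fun η => cylEnt_zero _) (Eventually.of_forall fun η => monotone_cylEnt _)
  · intro k
    exact MemLp.of_bound (measurable_cylEnt_kernel κ k).aestronglyMeasurable _
      (Eventually.of_forall fun η => abs_cylEnt_le (κ η) k)
  · intro k
    refine (integral_mono_of_nonneg (Eventually.of_forall fun η => sq_nonneg _)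
      (integrable_const (entBound A * ((k : ℝ) + 1) ^ 4))
      (Eventually.of_forall (hbd k))).trans ?_
    simp

end

/-! ### Laws of sequences with independent sections -/

/-- The section of the sequence `z` along `i, i q, i q ^ 2, …`, meaningful for `i ≥ 1`: the letter at
position `k ≥ 1` is `z (k - 1)`. -/
def sect {A : Type*} (q : ℕ) (z : ℕ → A) : ℕ → ℕ → A := fun i r => z (i * q ^ r - 1)

/-- The law of the sequence whose sections along `i, i q, i q ^ 2, …`, `q ∤ i`, are independent with
laws `ν i`. -/
noncomputable def prodLaw {A : Type*} [MeasurableSpace A] (q : ℕ) (ν : ℕ → Measure (ℕ → A)) :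
    Measure (ℕ → A) :=
  (Measure.infinitePi ν).map (assemble q)

theorem Pmu_eq_prodLaw {A : Type*} [MeasurableSpace A] (q : ℕ) (μ : Measure (ℕ → A)) :
    Pmu q μ = prodLaw q fun _ => μ := rfl

theorem sect_assemble {A : Type*} {q : ℕ} (hq : 2 ≤ q) (ω : ℕ → ℕ → A) {i : ℕ} (hi : ¬ q ∣ i) :
    sect q (assemble q ω) i = ω i :=
  funext fun r => assemble_apply hq ω hi r

theorem measurable_sect {A : Type*} [MeasurableSpace A] (q i : ℕ) :
    Measurable fun z : ℕ → A => sect q z i :=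
  measurable_pi_lambda _ fun _ => measurable_pi_apply _

theorem projY_sect {A₁ A₂ : Type*} (q : ℕ) (z : ℕ → A₁ × A₂) (i : ℕ) :
    projY (sect q z i) = sect q (projY z) i := rfl

theorem measurable_projY {A₁ A₂ : Type*} [MeasurableSpace A₁] [MeasurableSpace A₂] :
    Measurable (projY : (ℕ → A₁ × A₂) → ℕ → A₂) :=
  measurable_pi_lambda _ fun k => measurable_snd.comp (measurable_pi_apply k)

/-- The first `n` terms of a sequence determine, and are determined by, the first `len q n i` terms
of its sections along the progressions that start at some `i ∈ idx q n`. -/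
theorem assemble_preimage_cyl {A : Type*} {q : ℕ} (hq : 2 ≤ q) (n : ℕ) (z : ℕ → A) :
    assemble q ⁻¹' cyl (pre n z) =
      Set.pi (idx q n : Set ℕ) fun i => cyl (pre (len q n i) (sect q z i)) := by
  ext ω
  simp only [cyl, pre, Set.mem_preimage, Set.mem_ofPred_eq, Set.mem_pi, Finset.mem_coe]
  constructor
  · intro h i hi r
    obtain ⟨⟨hi1, hin⟩, hqi⟩ := mem_idx.1 hi
    have hr := (lt_len_iff hq hi1 hin).1 r.2
    have hpos : 0 < i * q ^ (r : ℕ) := Nat.mul_pos hi1 (Nat.pow_pos (by omega))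
    exact (assemble_apply hq ω hqi r).symm.trans (h ⟨i * q ^ (r : ℕ) - 1, by omega⟩)
  · intro h k
    obtain ⟨i, r, hi, hi1, hik, hk, hkr⟩ := exists_position hq (k : ℕ)
    have hkn := k.2
    rw [hk, assemble_apply hq ω hi r]
    exact h i (mem_idx.2 ⟨⟨hi1, by omega⟩, hi⟩)
      ⟨r, (lt_len_iff hq hi1 (by omega)).2 (by omega)⟩

section

variable {A : Type*} [MeasurableSpace A]

instance (q : ℕ) (ν : ℕ → Measure (ℕ → A)) [∀ i, IsProbabilityMeasure (ν i)] :
    IsProbabilityMeasure (prodLaw q ν) :=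
  Measure.isProbabilityMeasure_map (measurable_assemble q).aemeasurable

theorem prodLaw_map_projY {A₁ A₂ : Type*} [MeasurableSpace A₁] [MeasurableSpace A₂] (q : ℕ)
    (ν : ℕ → Measure (ℕ → A₁ × A₂)) [∀ i, IsProbabilityMeasure (ν i)] :
    (prodLaw q ν).map projY = prodLaw q fun i => (ν i).map projY := by
  rw [prodLaw, prodLaw, Measure.map_map measurable_projY (measurable_assemble q),
    ← Measure.infinitePi_map_pi ν (fun _ => measurable_projY),
    Measure.map_map (measurable_assemble q)]
  · rfl
  · exact measurable_pi_lambda _ fun i => measurable_projY.comp (measurable_pi_apply i)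

variable [MeasurableSingletonClass A]

theorem prodLaw_cyl {q : ℕ} (hq : 2 ≤ q) (ν : ℕ → Measure (ℕ → A))
    [∀ i, IsProbabilityMeasure (ν i)] (n : ℕ) (z : ℕ → A) :
    prodLaw q ν (cyl (pre n z)) = ∏ i ∈ idx q n, ν i (cyl (pre (len q n i) (sect q z i))) := by
  rw [prodLaw, Measure.map_apply (measurable_assemble q) (measurableSet_cyl _),
    assemble_preimage_cyl hq, Measure.infinitePi_pi]
  exact fun i _ => measurableSet_cyl _

theorem info_prodLaw {q : ℕ} (hq : 2 ≤ q) (ν : ℕ → Measure (ℕ → A))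
    [∀ i, IsProbabilityMeasure (ν i)] {n : ℕ} {z : ℕ → A}
    (hpos : 0 < (prodLaw q ν).real (cyl (pre n z))) :
    info (prodLaw q ν) n z = ∑ i ∈ idx q n, info (ν i) (len q n i) (sect q z i) := by
  have h : (prodLaw q ν).real (cyl (pre n z)) =
      ∏ i ∈ idx q n, (ν i).real (cyl (pre (len q n i) (sect q z i))) := by
    simp only [Measure.real, prodLaw_cyl hq, ENNReal.toReal_prod]
  simp only [info]
  rw [h] at hpos ⊢
  rw [Real.log_prod fun i hi => Finset.prod_ne_zero_iff.1 hpos.ne' i hi, Finset.sum_neg_distrib]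

variable [Fintype A]

theorem cylEnt_prodLaw {q : ℕ} (hq : 2 ≤ q) (ν : ℕ → Measure (ℕ → A))
    [∀ i, IsProbabilityMeasure (ν i)] (n : ℕ) :
    cylEnt (prodLaw q ν) n = ∑ i ∈ idx q n, cylEnt (ν i) (len q n i) := by
  have hmp : ∀ i, MeasurePreserving (Function.eval i) (Measure.infinitePi ν) (ν i) := fun i =>
    measurePreserving_eval_infinitePi ν i
  have hsm : ∀ i, i ∈ idx q n →
      MeasurePreserving (fun z => sect q z i) (prodLaw q ν) (ν i) := by
    intro i hi
    refine ⟨measurable_sect q i, ?_⟩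
    rw [prodLaw, Measure.map_map (measurable_sect q i) (measurable_assemble q), ← (hmp i).map_eq]
    congr 1
    exact funext fun ω => sect_assemble hq ω (mem_idx.1 hi).2
  have hinfo : ∀ (i k : ℕ), Measurable (info (ν i) k) := fun i k =>
    (measurable_of_finite fun u => -Real.log ((ν i).real (cyl u))).comp (measurable_pre k)
  have h1 : ∫ z, info (prodLaw q ν) n z ∂prodLaw q ν =
      ∫ z, ∑ i ∈ idx q n, info (ν i) (len q n i) (sect q z i) ∂prodLaw q ν := by
    refine integral_congr_ae ?_
    filter_upwards [ae_cyl_pos (prodLaw q ν)] with z hz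
    exact info_prodLaw hq ν (hz n)
  rw [← integral_info, h1, integral_finsetSum]
  · refine Finset.sum_congr rfl fun i hi => ?_
    rw [← integral_info]
    have h2 := integral_map (μ := prodLaw q ν) (hsm i hi).measurable.aemeasurable
      (hinfo i (len q n i)).aestronglyMeasurable
    rw [(hsm i hi).map_eq] at h2
    exact h2.symm
  · intro i hi
    exact (hsm i hi).integrable_comp_of_integrable (integrable_info (ν i) (len q n i))

end

/-! ### Disintegration along the second coordinate -/

theorem measurable_of_measurable_cyl {A E : Type*} [Fintype A] [MeasurableSpace A]
    [MeasurableSingletonClass A] [MeasurableSpace E] {κ : E → Measure (ℕ → A)}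
    [∀ η, IsProbabilityMeasure (κ η)]
    (h : ∀ k (u : Fin k → A), Measurable fun η => κ η (cyl u)) : Measurable κ := by
  refine Measurable.measure_of_isPiSystem_of_isProbabilityMeasure
    generateFrom_measurableCylinders.symm isPiSystem_measurableCylinders fun t ht => ?_
  obtain ⟨k, S, rfl⟩ := measurableCylinder_eq ht
  classical
  have hS : ∀ η, κ η (pre k ⁻¹' S) = ∑ u with u ∈ S, κ η (cyl u) := by
    intro η
    have hs := sum_measure_singleton (μ := (κ η).map (pre k)) (s := Finset.univ.filter (· ∈ S))
    simp only [Finset.coe_filter, Finset.mem_univ, true_and, Set.ofPred_mem_eq] at hs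
    rw [← Measure.map_apply (measurable_pre k) (Set.toFinite S).measurableSet, ← hs]
    refine Finset.sum_congr rfl fun u _ => ?_
    rw [Measure.map_apply (measurable_pre k) (measurableSet_singleton u), cyl_eq_preimage]
  simp only [hS]
  exact Finset.measurable_sum _ fun u _ => h k u

/-- Two probability measures on pairs of sequences agree if they agree on products of cylinders of
the same length. -/
theorem ext_of_cyl_prod {A B : Type*} [Fintype A] [MeasurableSpace A] [MeasurableSingletonClass A]
    [Nonempty A] [Nonempty B] [Fintype B] [MeasurableSpace B] [MeasurableSingletonClass B]
    {M M' : Measure ((ℕ → B) × (ℕ → A))}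
    [IsProbabilityMeasure M] [IsProbabilityMeasure M']
    (h : ∀ n (y : ℕ → B) (z : ℕ → A), M (cyl (pre n y) ×ˢ cyl (pre n z)) =
      M' (cyl (pre n y) ×ˢ cyl (pre n z))) : M = M' := by
  let zip : (ℕ → B) × (ℕ → A) → ℕ → B × A := fun p k => (p.1 k, p.2 k)
  let unzip : (ℕ → B × A) → (ℕ → B) × (ℕ → A) := fun w => (fun k => (w k).1, fun k => (w k).2)
  have hz : Measurable zip := measurable_pi_lambda _ fun k =>
    ((measurable_pi_apply k).comp measurable_fst).prodMk
      ((measurable_pi_apply k).comp measurable_snd)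
  have hu : Measurable unzip := Measurable.prodMk
    (measurable_pi_lambda _ fun k => measurable_fst.comp (measurable_pi_apply k))
    (measurable_pi_lambda _ fun k => measurable_snd.comp (measurable_pi_apply k))
  have : IsProbabilityMeasure (M.map zip) := Measure.isProbabilityMeasure_map hz.aemeasurable
  have : IsProbabilityMeasure (M'.map zip) := Measure.isProbabilityMeasure_map hz.aemeasurable
  have key : M.map zip = M'.map zip := by
    refine ext_of_cyl fun n u => ?_
    obtain ⟨w, rfl⟩ := exists_pre_eq u
    have hpre : zip ⁻¹' cyl (pre n w) =
        cyl (pre n (unzip w).1) ×ˢ cyl (pre n (unzip w).2) := by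
      ext p
      simp [cyl, pre, zip, unzip, Prod.ext_iff, forall_and]
    rw [Measure.map_apply hz (measurableSet_cyl _), Measure.map_apply hz (measurableSet_cyl _),
      hpre, h]
  have hid : ∀ M : Measure ((ℕ → B) × (ℕ → A)), (M.map zip).map unzip = M := by
    intro M
    rw [Measure.map_map hu hz]
    exact Measure.map_id
  rw [← hid M, key, hid]

theorem Pmu_map_projY {m₁ m₂ : ℕ} (q : ℕ) (μ : Measure (ℕ → Fin m₁ × Fin m₂))
    [IsProbabilityMeasure μ] :
    (Pmu q μ).map projY = Pmu q (μ.map projY) := prodLaw_map_projY q fun _ => μ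

section

variable {m₁ m₂ : ℕ} [NeZero m₁] [NeZero m₂]

instance (ν : Measure (ℕ → Fin m₁ × Fin m₂)) [IsFiniteMeasure ν] : IsMarkovKernel (disint ν) := by
  unfold disint; infer_instance

theorem compProd_disint (ν : Measure (ℕ → Fin m₁ × Fin m₂)) [IsFiniteMeasure ν] :
    ν.map projY ⊗ₘ disint ν = ν.map fun z => (projY z, z) :=
  compProd_map_condDistrib aemeasurable_id

theorem setLIntegral_disint (ν : Measure (ℕ → Fin m₁ × Fin m₂)) [IsFiniteMeasure ν]
    {s : Set (ℕ → Fin m₂)} (hs : MeasurableSet s) {t : Set (ℕ → Fin m₁ × Fin m₂)}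
    (ht : MeasurableSet t) :
    ∫⁻ y in s, disint ν y t ∂ν.map projY = ν (projY ⁻¹' s ∩ t) := by
  have hm : Measurable fun z : ℕ → Fin m₁ × Fin m₂ => (projY z, z) :=
    measurable_projY.prodMk measurable_id
  rw [← Measure.compProd_apply_prod hs ht, compProd_disint, Measure.map_apply hm (hs.prod ht)]
  rfl

/-- The kernel that sends `y` to the law of the sequence whose sections along `i, i q, …`, `q ∤ i`,
are independent, with laws the conditional laws under `μ` given the sections of `y`. -/
noncomputable def prodKernel {q : ℕ} (hq : 2 ≤ q) (μ : Measure (ℕ → Fin m₁ × Fin m₂))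
    [IsProbabilityMeasure μ] : Kernel (ℕ → Fin m₂) (ℕ → Fin m₁ × Fin m₂) where
  toFun y := prodLaw q fun i => disint μ (sect q y i)
  measurable' := by
    refine measurable_of_measurable_cyl fun n u => ?_
    obtain ⟨z, rfl⟩ := exists_pre_eq u
    simp only [prodLaw_cyl hq]
    exact Finset.measurable_prod _ fun i _ =>
      ((disint μ).measurable_coe (measurableSet_cyl _)).comp (measurable_sect q i)

theorem prodKernel_apply {q : ℕ} (hq : 2 ≤ q) (μ : Measure (ℕ → Fin m₁ × Fin m₂))
    [IsProbabilityMeasure μ] (y : ℕ → Fin m₂) :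
    prodKernel hq μ y = prodLaw q fun i => disint μ (sect q y i) := rfl

instance {q : ℕ} (hq : 2 ≤ q) (μ : Measure (ℕ → Fin m₁ × Fin m₂)) [IsProbabilityMeasure μ] :
    IsMarkovKernel (prodKernel hq μ) :=
  ⟨fun y => by rw [prodKernel_apply]; infer_instance⟩

instance (ν : Measure (ℕ → Fin m₁ × Fin m₂)) [IsProbabilityMeasure ν] :
    IsProbabilityMeasure (ν.map projY) :=
  Measure.isProbabilityMeasure_map measurable_projY.aemeasurable

/-- Conditionally on its second coordinate, a sequence with law `Pmu q μ` still has independent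
sections. -/
theorem disint_Pmu {q : ℕ} (hq : 2 ≤ q) (μ : Measure (ℕ → Fin m₁ × Fin m₂))
    [IsProbabilityMeasure μ] :
    ∀ᵐ y ∂(Pmu q μ).map projY,
      disint (Pmu q μ) y = prodLaw q fun i => disint μ (sect q y i) := by
  -- By uniqueness of the disintegration, it suffices to compare the joint laws, on cylinders.
  refine condDistrib_ae_eq_of_measure_eq_compProd (κ := prodKernel hq μ) _ aemeasurable_id ?_
  have hm : Measurable fun z : ℕ → Fin m₁ × Fin m₂ => (projY z, id z) :=
    measurable_projY.prodMk measurable_id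
  have : IsProbabilityMeasure ((Pmu q μ).map fun z => (projY z, id z)) :=
    Measure.isProbabilityMeasure_map hm.aemeasurable
  refine ext_of_cyl_prod fun n y z => ?_
  have hleft : (Pmu q μ).map (fun z => (projY z, id z)) (cyl (pre n y) ×ˢ cyl (pre n z)) =
      ∏ i ∈ idx q n, μ (projY ⁻¹' cyl (pre (len q n i) (sect q y i)) ∩
        cyl (pre (len q n i) (sect q z i))) := by
    rw [Measure.map_apply hm ((measurableSet_cyl _).prod (measurableSet_cyl _)), Pmu,
      Measure.map_apply (measurable_assemble q)
        (hm ((measurableSet_cyl _).prod (measurableSet_cyl _))),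
      ← Measure.infinitePi_pi (fun _ : ℕ => μ)]
    · congr 1
      have hy : ∀ ω : ℕ → ℕ → Fin m₁ × Fin m₂, projY (assemble q ω) ∈ cyl (pre n y) ↔
          (fun i => projY (ω i)) ∈ assemble q ⁻¹' cyl (pre n y) := fun ω => Iff.rfl
      have hz : ∀ ω : ℕ → ℕ → Fin m₁ × Fin m₂, assemble q ω ∈ cyl (pre n z) ↔
          ω ∈ assemble q ⁻¹' cyl (pre n z) := fun ω => Iff.rfl
      ext ω
      simp only [Set.mem_preimage, Set.mem_prod, id]
      rw [hy, hz, assemble_preimage_cyl hq, assemble_preimage_cyl hq]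
      simp only [Set.mem_pi, Set.mem_inter_iff, Set.mem_preimage]
      exact ⟨fun h i hi => ⟨h.1 i hi, h.2 i hi⟩,
        fun h => ⟨fun i hi => (h i hi).1, fun i hi => (h i hi).2⟩⟩
    · exact fun i _ => (measurable_projY (measurableSet_cyl _)).inter (measurableSet_cyl _)
  rw [hleft, Measure.compProd_apply_prod (measurableSet_cyl _) (measurableSet_cyl _),
    Pmu_map_projY, Pmu, setLIntegral_map (measurableSet_cyl _)
      ((prodKernel hq μ).measurable_coe (measurableSet_cyl _)) (measurable_assemble q),
    assemble_preimage_cyl hq]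
  set D : ℕ → (ℕ → Fin m₂) → ENNReal := fun i =>
    (cyl (pre (len q n i) (sect q y i))).indicator fun η =>
      disint μ η (cyl (pre (len q n i) (sect q z i))) with hD
  have hDm : ∀ i, Measurable (D i) := fun i =>
    ((disint μ).measurable_coe (measurableSet_cyl _)).indicator (measurableSet_cyl _)
  have hind : ∀ η : ℕ → ℕ → Fin m₂,
      (Set.pi (idx q n : Set ℕ) fun i => cyl (pre (len q n i) (sect q y i))).indicator
        (fun η => prodKernel hq μ (assemble q η) (cyl (pre n z))) η =
        ∏ i ∈ idx q n, D i (η i) := by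
    intro η
    by_cases hη : η ∈ Set.pi (idx q n : Set ℕ) fun i => cyl (pre (len q n i) (sect q y i))
    · rw [Set.indicator_of_mem hη, prodKernel_apply, prodLaw_cyl hq]
      refine Finset.prod_congr rfl fun i hi => ?_
      rw [sect_assemble hq η (mem_idx.1 hi).2]
      have h1 : D i (η i) = disint μ (η i) (cyl (pre (len q n i) (sect q z i))) :=
        Set.indicator_of_mem (hη i hi) _
      exact h1.symm
    · rw [Set.indicator_of_notMem hη]
      obtain ⟨i, hi, hiη⟩ : ∃ i ∈ idx q n, η i ∉ cyl (pre (len q n i) (sect q y i)) := by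
        simpa [Set.mem_pi] using hη
      have h1 : D i (η i) = 0 := Set.indicator_of_notMem hiη _
      exact (Finset.prod_eq_zero hi h1).symm
  rw [← lintegral_indicator (MeasurableSet.pi (Set.to_countable _) fun i _ => measurableSet_cyl _)]
  simp only [hind]
  rw [lintegral_prod_eq_prod_lintegral_of_indepFun (idx q n)
    (fun i (η : ℕ → ℕ → Fin m₂) => D i (η i))
    (iIndepFun_infinitePi (X := D) hDm) (fun i => (hDm i).comp (measurable_pi_apply i))]
  refine Finset.prod_congr rfl fun i _ => ?_
  have h1 := (measurePreserving_eval_infinitePi (fun _ : ℕ => μ.map projY) i).lintegral_comp (hDm i)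
  refine Eq.trans ?_ h1.symm
  rw [hD, lintegral_indicator (measurableSet_cyl _),
    setLIntegral_disint μ (measurableSet_cyl _) (measurableSet_cyl _)]

end

/-! ### Balls and local dimensions -/

/-- A ball of radius `r` is a cylinder whose length is the ceiling of `-log r / log b`. -/
theorem tendsto_neg_div_log {b : ℝ} (hb : 1 < b) {g : ℕ → ℝ} {h : ℝ}
    (hg : Tendsto (fun n : ℕ => g n / n) atTop (𝓝 h)) :
    Tendsto (fun r : ℝ => -g ⌈-Real.log r / Real.log b⌉₊ / Real.log r) (𝓝[>] 0)
      (𝓝 (h / Real.log b)) := by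
  have hlb : 0 < Real.log b := Real.log_pos hb
  have ht : Tendsto (fun r : ℝ => -Real.log r / Real.log b) (𝓝[>] 0) atTop :=
    (tendsto_neg_atBot_atTop.comp Real.tendsto_log_nhdsGT_zero).atTop_div_const hlb
  have h1 := (hg.comp (tendsto_nat_ceil_atTop.comp ht)).mul
    ((tendsto_nat_ceil_div_atTop (R := ℝ)).comp ht)
  have h2 := h1.div_const (Real.log b)
  rw [mul_one] at h2
  refine h2.congr' ?_
  filter_upwards [ht.eventually_gt_atTop 0] with r hr
  simp only [Function.comp]
  have hN : (0 : ℝ) < (⌈-Real.log r / Real.log b⌉₊ : ℕ) := by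
    exact_mod_cast Nat.ceil_pos.2 hr
  have hlr : Real.log r ≠ 0 := by
    rintro h0; simp [h0] at hr
  generalize ⌈-Real.log r / Real.log b⌉₊ = N at hN
  field_simp

theorem mem_cyl_pre_iff {A : Type*} {n : ℕ} {z w : ℕ → A} (hzw : z ≠ w) :
    w ∈ cyl (pre n z) ↔ n ≤ PiNat.firstDiff z w := by
  rw [PiNat.firstDiff_comm, ← PiNat.mem_cylinder_iff_le_firstDiff hzw.symm,
    PiNat.mem_cylinder_iff]
  exact ⟨fun h i hi => h ⟨i, hi⟩, fun h i => h i i.2⟩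

theorem rpow_neg_le_iff {b c : ℝ} (hb : 1 < b) (hc : 0 < c) (k : ℕ) {r : ℝ} (hr : 0 < r) :
    b ^ (-(c * k)) ≤ r ↔ ⌈-Real.log r / (c * Real.log b)⌉₊ ≤ k := by
  have hlb : 0 < Real.log b := Real.log_pos hb
  rw [Nat.ceil_le, div_le_iff₀ (by positivity), ← Real.log_le_log_iff (by positivity) hr,
    Real.log_rpow (by linarith)]
  constructor <;> intro h <;> linarith

section

variable {m₁ m₂ : ℕ}

theorem gam_mul_log (hm₁ : 2 ≤ m₁) : gam m₁ m₂ * Real.log m₁ = Real.log m₂ := by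
  have : 0 < Real.log m₁ := Real.log_pos (by exact_mod_cast hm₁)
  rw [gam, div_mul_cancel₀ _ this.ne']

theorem distY_le_iff (hm₁ : 2 ≤ m₁) (hm₂ : 2 ≤ m₂) (y w : ℕ → Fin m₂) {r : ℝ} (hr : 0 < r) :
    distY m₁ m₂ y w ≤ r ↔ w ∈ cyl (pre ⌈-Real.log r / Real.log m₂⌉₊ y) := by
  have h1 : (1 : ℝ) < m₁ := by exact_mod_cast hm₁
  have h2 : (1 : ℝ) < m₂ := by exact_mod_cast hm₂
  have hg : 0 < gam m₁ m₂ := div_pos (Real.log_pos h2) (Real.log_pos h1)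
  rw [distY]
  split_ifs with h
  · subst h
    exact ⟨fun _ => self_mem_cyl _ _, fun _ => hr.le⟩
  · rw [mem_cyl_pre_iff h, rpow_neg_le_iff h1 hg _ hr, gam_mul_log hm₁]

theorem distXY_le_iff (hm₁ : 2 ≤ m₁) (hm₂ : 2 ≤ m₂) (z w : ℕ → Fin m₁ × Fin m₂) {r : ℝ}
    (hr : 0 < r) :
    distXY m₁ m₂ z w ≤ r ↔ w ∈ cyl (pre ⌈-Real.log r / Real.log m₁⌉₊ z) ∧
      projY w ∈ cyl (pre ⌈-Real.log r / Real.log m₂⌉₊ (projY z)) := by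
  have h1 : (1 : ℝ) < m₁ := by exact_mod_cast hm₁
  rw [distXY, max_le_iff, distY_le_iff hm₁ hm₂ _ _ hr]
  refine and_congr_left fun _ => ?_
  split_ifs with h
  · subst h
    exact ⟨fun _ => self_mem_cyl _ _, fun _ => hr.le⟩
  · have h3 := rpow_neg_le_iff h1 one_pos (PiNat.firstDiff z w) hr
    rw [one_mul, one_mul] at h3
    rw [mem_cyl_pre_iff h, h3]

theorem isExactDimensional_distY (hm₁ : 2 ≤ m₁) (hm₂ : 2 ≤ m₂) {ν : Measure (ℕ → Fin m₂)} {h : ℝ}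
    (hν : ∀ᵐ y ∂ν, Tendsto (fun n : ℕ => info ν n y / n) atTop (𝓝 h)) :
    IsExactDimensional (distY m₁ m₂) ν := by
  refine ⟨h / Real.log m₂, ?_⟩
  filter_upwards [hν] with y hy
  refine (tendsto_neg_div_log (by exact_mod_cast hm₂) hy).congr' ?_
  filter_upwards [self_mem_nhdsWithin] with r hr
  have hball : {w | distY m₁ m₂ y w ≤ r} = cyl (pre ⌈-Real.log r / Real.log m₂⌉₊ y) :=
    Set.ext fun w => distY_le_iff hm₁ hm₂ y w hr
  rw [hball, info, neg_neg]

/-- On a single fibre of the projection to the second coordinate, the balls are cylinders. -/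
theorem isExactDimensional_distXY (hm₁ : 2 ≤ m₁) (hm₂ : 2 ≤ m₂)
    {ν : Measure (ℕ → Fin m₁ × Fin m₂)} {y : ℕ → Fin m₂} (hy : ∀ᵐ z ∂ν, projY z = y) {h : ℝ}
    (hν : ∀ᵐ z ∂ν, Tendsto (fun n : ℕ => info ν n z / n) atTop (𝓝 h)) :
    IsExactDimensional (distXY m₁ m₂) ν := by
  refine ⟨h / Real.log m₁, ?_⟩
  filter_upwards [hν, hy] with z hz hzy
  refine (tendsto_neg_div_log (by exact_mod_cast hm₁) hz).congr' ?_
  filter_upwards [self_mem_nhdsWithin] with r hr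
  have hball : ν.real {w | distXY m₁ m₂ z w ≤ r} =
      ν.real (cyl (pre ⌈-Real.log r / Real.log m₁⌉₊ z)) := by
    refine measureReal_congr ?_
    filter_upwards [hy] with w hw
    refine propext ((distXY_le_iff hm₁ hm₂ z w hr).trans ⟨fun h => h.1, fun h => ⟨h, ?_⟩⟩)
    rw [hw, hzy]
    exact self_mem_cyl _ _
  rw [hball, info, neg_neg]

end

/-! ### Conditional entropy -/

/-- Grouping the words `u` by their projections gives the entropy of the projected measure. -/
theorem sum_mul_log_projY {m₁ m₂ : ℕ} (μ : Measure (ℕ → Fin m₁ × Fin m₂))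
    [IsProbabilityMeasure μ] (k : ℕ) :
    ∑ u : Fin k → Fin m₁ × Fin m₂,
      μ.real (cyl u) * Real.log ((μ.map projY).real (cyl fun j => (u j).2)) =
        -cylEnt (μ.map projY) k := by
  rw [← integral_info (μ.map projY) k, integral_map measurable_projY.aemeasurable
    (integrable_info (μ.map projY) k).aestronglyMeasurable, ← integral_neg,
    ← integral_comp_pre μ k fun u => Real.log ((μ.map projY).real (cyl fun j => (u j).2))]
  refine integral_congr_ae (Eventually.of_forall fun z => ?_)
  simp only [info, neg_neg]
  rfl

section

variable {m₁ m₂ : ℕ} [NeZero m₁] [NeZero m₂]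

/-- A property that holds almost surely holds almost surely for almost every conditional measure,
which moreover lives on its fibre. -/
theorem ae_disint_of_ae (ν : Measure (ℕ → Fin m₁ × Fin m₂)) [IsFiniteMeasure ν]
    {p : (ℕ → Fin m₂) → (ℕ → Fin m₁ × Fin m₂) → Prop} (hp : ∀ᵐ z ∂ν, ∀ y, projY z = y → p y z) :
    ∀ᵐ y ∂ν.map projY, ∀ᵐ z ∂disint ν y, projY z = y ∧ p y z := by
  have hm : Measurable fun z : ℕ → Fin m₁ × Fin m₂ => (projY z, z) :=
    measurable_projY.prodMk measurable_id
  suffices h : ∀ᵐ x ∂(ν.map projY ⊗ₘ disint ν), projY x.2 = x.1 ∧ p x.1 x.2 from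
    Measure.ae_ae_of_ae_compProd h
  rw [compProd_disint]
  have h1 : ∀ᵐ x ∂ν.map (fun z : ℕ → Fin m₁ × Fin m₂ => (projY z, z)), projY x.2 = x.1 :=
    (ae_map_iff hm.aemeasurable (measurableSet_eq_fun
      (measurable_projY.comp measurable_snd) measurable_fst)).2 (Eventually.of_forall fun z => rfl)
  have h2 : MeasurePreserving Prod.snd (ν.map fun z : ℕ → Fin m₁ × Fin m₂ => (projY z, z)) ν := by
    refine ⟨measurable_snd, ?_⟩
    rw [Measure.map_map measurable_snd hm]
    exact Measure.map_id
  filter_upwards [h1, h2.quasiMeasurePreserving.ae hp] with x hx hx'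
  exact ⟨hx, hx' _ hx⟩

theorem projY_image_cyl {k : ℕ} (u : Fin k → Fin m₁ × Fin m₂) :
    projY '' cyl u = cyl fun j => (u j).2 := by
  ext y
  constructor
  · rintro ⟨z, hz, rfl⟩ j
    exact congrArg Prod.snd (hz j)
  · intro hy
    obtain ⟨z, rfl⟩ := exists_pre_eq u
    refine ⟨fun j => if j < k then z j else (0, y j), fun j => by simp [pre], ?_⟩
    funext j
    by_cases hj : j < k
    · simpa [projY, hj, pre] using (hy ⟨j, hj⟩).symm
    · simp [projY, hj]

variable (μ : Measure (ℕ → Fin m₁ × Fin m₂)) [IsProbabilityMeasure μ]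

theorem ae_disint_cyl_eq_zero {k : ℕ} (u : Fin k → Fin m₁ × Fin m₂) :
    ∀ᵐ y ∂μ.map projY, y ∉ cyl (fun j => (u j).2) → (disint μ y).real (cyl u) = 0 := by
  filter_upwards [ae_disint_of_ae μ (p := fun _ _ => True) (by simp)] with y hy hyu
  rw [measureReal_eq_zero_iff, measure_eq_zero_iff_ae_notMem]
  filter_upwards [hy] with z hz hzu
  refine hyu ?_
  rw [← hz.1, ← projY_image_cyl]
  exact ⟨z, hzu, rfl⟩

theorem integrable_comp_disint {F : ℝ → ℝ} (hF : Continuous F) {k : ℕ}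
    (u : Fin k → Fin m₁ × Fin m₂) :
    Integrable (fun y => F ((disint μ y).real (cyl u))) (μ.map projY) := by
  obtain ⟨C, hC⟩ := (isCompact_Icc (a := (0 : ℝ)) (b := 1)).exists_bound_of_continuousOn
    hF.continuousOn
  exact Integrable.of_bound
    (hF.measurable.comp (measurable_kernel_real (disint μ) u)).aestronglyMeasurable C
    (Eventually.of_forall fun y => hC _ ⟨measureReal_nonneg, measureReal_le_one⟩)

theorem setIntegral_disint_cyl {k : ℕ} (u : Fin k → Fin m₁ × Fin m₂) :
    ∫ y in cyl (fun j => (u j).2), (disint μ y).real (cyl u) ∂μ.map projY = μ.real (cyl u) := by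
  have h := setLIntegral_disint μ (measurableSet_cyl fun j => (u j).2) (measurableSet_cyl u)
  have hsub : projY ⁻¹' cyl (fun j => (u j).2) ∩ cyl u = cyl u := by
    refine Set.inter_eq_right.2 fun z hz => ?_
    rw [← projY_image_cyl]
    exact ⟨z, hz, rfl⟩
  rw [hsub] at h
  rw [Measure.real, ← h]
  exact integral_toReal ((disint μ).measurable_coe (measurableSet_cyl u)).aemeasurable
    (Eventually.of_forall fun y => measure_lt_top _ _)

/-- Jensen's inequality for the strictly concave function `-t log t` on the cylinder `π [u]`, whose
equality case is that the conditional probability of `[u]` is almost surely constant there. -/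
theorem integral_negMulLog_disint_le {k : ℕ} (u : Fin k → Fin m₁ × Fin m₂) :
    ∫ y, Real.negMulLog ((disint μ y).real (cyl u)) ∂μ.map projY ≤
        Real.negMulLog (μ.real (cyl u)) +
          μ.real (cyl u) * Real.log ((μ.map projY).real (cyl fun j => (u j).2)) ∧
      (∫ y, Real.negMulLog ((disint μ y).real (cyl u)) ∂μ.map projY =
        Real.negMulLog (μ.real (cyl u)) +
          μ.real (cyl u) * Real.log ((μ.map projY).real (cyl fun j => (u j).2)) ↔
        ∃ c : ℝ, ∀ᵐ y ∂μ.map projY,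
          y ∈ cyl (fun j => (u j).2) → (disint μ y).real (cyl u) = c) := by
  set τ := μ.map projY with hτ
  set V := cyl fun j => (u j).2 with hV
  have hVm : MeasurableSet V := measurableSet_cyl _
  set s : (ℕ → Fin m₂) → ℝ := fun y => (disint μ y).real (cyl u) with hs
  have hI : ∫ y, Real.negMulLog (s y) ∂τ = ∫ y in V, Real.negMulLog (s y) ∂τ := by
    refine (setIntegral_eq_integral_of_ae_compl_eq_zero ?_).symm
    filter_upwards [ae_disint_cyl_eq_zero μ u] with y hy hyV
    simp only [hs, hy hyV, Real.negMulLog_zero]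
  have hmean : ∫ y in V, s y ∂τ = μ.real (cyl u) := setIntegral_disint_cyl μ u
  rw [hI]
  by_cases hV0 : τ V = 0
  · have hr : τ.restrict V = 0 := Measure.restrict_eq_zero.2 hV0
    have hμ0 : μ.real (cyl u) = 0 := by rw [← hmean, hr, integral_zero_measure]
    rw [hr, integral_zero_measure, hμ0]
    simp only [Real.negMulLog_zero, zero_mul, add_zero, le_refl, true_and, true_iff]
    refine ⟨0, ?_⟩
    filter_upwards [measure_eq_zero_iff_ae_notMem.1 hV0] with y hy hyV
    exact absurd hyV hy
  have hp : 0 < τ.real V := ENNReal.toReal_pos hV0 (measure_ne_top _ _)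
  have hrhs : Real.negMulLog (μ.real (cyl u)) + μ.real (cyl u) * Real.log (τ.real V) =
      τ.real V * Real.negMulLog ((τ.real V)⁻¹ * μ.real (cyl u)) := by
    rcases eq_or_ne (μ.real (cyl u)) 0 with h0 | h0
    · simp [h0]
    · rw [Real.negMulLog, Real.negMulLog, Real.log_mul (inv_ne_zero hp.ne') h0, Real.log_inv]
      field_simp
      ring
  rw [hrhs]
  have hsi : Integrable s (τ.restrict V) :=
    (integrable_comp_disint μ continuous_id u).integrableOn
  have hφi : Integrable (Real.negMulLog ∘ s) (τ.restrict V) :=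
    (integrable_comp_disint μ Real.continuous_negMulLog u).integrableOn
  have havg : ⨍ y in V, s y ∂τ = (τ.real V)⁻¹ * μ.real (cyl u) := by
    rw [setAverage_eq, hmean, smul_eq_mul]
  have havg' : ⨍ y in V, Real.negMulLog (s y) ∂τ =
      (τ.real V)⁻¹ * ∫ y in V, Real.negMulLog (s y) ∂τ := by
    rw [setAverage_eq, smul_eq_mul]
  -- If `s` is constant on `V`, then both sides are equal.
  have hconst : ∀ c : ℝ, (∀ᵐ y ∂τ.restrict V, s y = c) →
      ∫ y in V, Real.negMulLog (s y) ∂τ =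
        τ.real V * Real.negMulLog ((τ.real V)⁻¹ * μ.real (cyl u)) := by
    intro c hc
    have h1 : ∫ y in V, s y ∂τ = τ.real V * c := by
      rw [integral_congr_ae hc, setIntegral_const, smul_eq_mul]
    have h2 : ∫ y in V, Real.negMulLog (s y) ∂τ = τ.real V * Real.negMulLog c := by
      have : (fun y => Real.negMulLog (s y)) =ᵐ[τ.restrict V] fun _ => Real.negMulLog c := by
        filter_upwards [hc] with y hy
        rw [hy]
      rw [integral_congr_ae this, setIntegral_const, smul_eq_mul]
    rw [h2, ← hmean, h1, inv_mul_cancel_left₀ hp.ne']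
  have hae : ∀ c : ℝ, (∀ᵐ y ∂τ.restrict V, s y = c) ↔ ∀ᵐ y ∂τ, y ∈ V → s y = c := fun c =>
    ae_restrict_iff' hVm
  rw [show (∃ c : ℝ, ∀ᵐ y ∂τ, y ∈ V → (disint μ y).real (cyl u) = c) ↔ _ from
    exists_congr fun c => (hae c).symm]
  rcases Real.strictConcaveOn_negMulLog.ae_eq_const_or_lt_map_average
      Real.continuous_negMulLog.continuousOn isClosed_Ici
      (Eventually.of_forall fun y => (measureReal_nonneg : 0 ≤ s y)) hsi hφi with h | h
  · have h' := hconst _ h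
    exact ⟨h'.le, fun _ => ⟨_, h⟩, fun _ => h'⟩
  · rw [havg, havg', inv_mul_lt_iff₀ hp] at h
    exact ⟨h.le, fun h' => absurd h' h.ne, fun ⟨c, hc⟩ => hconst c hc⟩

/-- Conditioning on the whole sequence of second coordinates leaves at most the entropy that is
left by conditioning on the first `k` of them. -/
theorem cylEnt_add_integral_le (k : ℕ) :
    cylEnt (μ.map projY) k + ∫ y, cylEnt (disint μ y) k ∂μ.map projY ≤ cylEnt μ k ∧
      (cylEnt (μ.map projY) k + ∫ y, cylEnt (disint μ y) k ∂μ.map projY = cylEnt μ k ↔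
        ∀ u : Fin k → Fin m₁ × Fin m₂, ∃ c : ℝ, ∀ᵐ y ∂μ.map projY,
          y ∈ cyl (fun j => (u j).2) → (disint μ y).real (cyl u) = c) := by
  have h1 : ∫ y, cylEnt (disint μ y) k ∂μ.map projY =
      ∑ u : Fin k → Fin m₁ × Fin m₂,
        ∫ y, Real.negMulLog ((disint μ y).real (cyl u)) ∂μ.map projY :=
    integral_finsetSum _ fun u _ => integrable_comp_disint μ Real.continuous_negMulLog u
  have h2 : ∑ u : Fin k → Fin m₁ × Fin m₂, (Real.negMulLog (μ.real (cyl u)) +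
      μ.real (cyl u) * Real.log ((μ.map projY).real (cyl fun j => (u j).2))) =
        cylEnt μ k - cylEnt (μ.map projY) k := by
    rw [Finset.sum_add_distrib, sum_mul_log_projY]
    rfl
  have h3 := fun u : Fin k → Fin m₁ × Fin m₂ => integral_negMulLog_disint_le μ u
  have hle := Finset.sum_le_sum fun u (_ : u ∈ Finset.univ) => (h3 u).1
  have heq := Finset.sum_eq_sum_iff_of_le fun u (_ : u ∈ Finset.univ) => (h3 u).1
  rw [← h1, h2] at hle heq
  refine ⟨by linarith, ?_⟩
  rw [← eq_sub_iff_add_eq', heq]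
  simp only [Finset.mem_univ, true_imp_iff]
  exact forall_congr' fun u => (h3 u).2

end

/-! ### Dimensions of the measures `ℙ_μ` and of their conditional measures -/

theorem ae_Pmu_of_ae {A : Type*} [MeasurableSpace A] (q : ℕ) (μ : Measure (ℕ → A))
    {p : (ℕ → A) → Prop} (hp : MeasurableSet {z | p z})
    (h : ∀ᵐ ω ∂Measure.infinitePi (fun _ : ℕ => μ), p (assemble q ω)) : ∀ᵐ z ∂Pmu q μ, p z :=
  (ae_map_iff (measurable_assemble q).aemeasurable hp).2 h

theorem HasEntropyDim.dimE_eq {A : Type*} [Fintype A] [MeasurableSpace A] {ν : Measure (ℕ → A)}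
    {δ : ℝ} (h : HasEntropyDim ν δ) : dimE ν = δ :=
  Tendsto.limUnder_eq h

section

variable {A : Type*} [Fintype A] [Nonempty A] [MeasurableSpace A] [MeasurableSingletonClass A]
  {q : ℕ} (μ : Measure (ℕ → A)) [IsProbabilityMeasure μ]

theorem hasEntropyDim_Pmu (hq : 2 ≤ q) : HasEntropyDim (Pmu q μ) (lam q (cylEnt μ)) := by
  refine (tendsto_sum_len hq (cylEnt_zero μ) (abs_cylEnt_le μ)).congr fun n => ?_
  rw [entropyRate_eq, Pmu_eq_prodLaw, cylEnt_prodLaw hq]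

/-- The Shannon-McMillan-Breiman property of `ℙ_μ`. -/
theorem ae_tendsto_info_Pmu (hq : 2 ≤ q) :
    ∀ᵐ z ∂Pmu q μ, Tendsto (fun n : ℕ => info (Pmu q μ) n z / n) atTop (𝓝 (lam q (cylEnt μ))) := by
  have hinfo : ∀ k, Measurable (info μ k) := fun k =>
    (measurable_of_finite fun u => -Real.log (μ.real (cyl u))).comp (measurable_pre k)
  have h : ∀ᵐ z ∂Pmu q μ, Tendsto
      (fun n : ℕ => (∑ i ∈ idx q n, info μ (len q n i) (sect q z i)) / n) atTop
      (𝓝 (lam q (cylEnt μ))) := by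
    refine ae_Pmu_of_ae q μ ?_ ?_
    · exact measurableSet_tendsto _ fun n => (Finset.measurable_sum _ fun i _ =>
        (hinfo _).comp (measurable_sect q i)).div_const _
    -- Information is conditional information given a constant.
    · have hκ : μ.map (fun _ => ()) ⊗ₘ Kernel.const Unit μ = μ.map fun z => ((), z) := by
        rw [Measure.map_const, measure_univ, one_smul, Measure.compProd_const, Measure.dirac_prod]
      have h1 := ae_tendsto_sum_info (Kernel.const Unit μ) hq μ measurable_const hκ
      filter_upwards [h1] with ω hω
      simp only [Kernel.const_apply, integral_const, measureReal_def, measure_univ,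
        Measure.map_const, one_smul, ENNReal.toReal_one] at hω
      refine hω.congr fun n => ?_
      congr 1
      exact Finset.sum_congr rfl fun i hi => by rw [sect_assemble hq ω (mem_idx.1 hi).2]
  filter_upwards [h, ae_cyl_pos (Pmu q μ)] with z hz hpos
  refine hz.congr fun n => ?_
  rw [Pmu_eq_prodLaw, info_prodLaw hq _ (hpos n)]

end

section

variable {m₁ m₂ q : ℕ} [NeZero m₁] [NeZero m₂] (μ : Measure (ℕ → Fin m₁ × Fin m₂))
  [IsProbabilityMeasure μ]

/-- By independence of the sections, the entropy dimension of almost every conditional measure is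
the weighted sum of the mean conditional entropies. -/
theorem ae_hasEntropyDim_disint (hq : 2 ≤ q) :
    ∀ᵐ y ∂(Pmu q μ).map projY, HasEntropyDim (disint (Pmu q μ) y)
      (lam q fun k => ∫ y, cylEnt (disint μ y) k ∂μ.map projY) := by
  have h : ∀ᵐ y ∂(Pmu q μ).map projY, Tendsto
      (fun n : ℕ => (∑ i ∈ idx q n, cylEnt (disint μ (sect q y i)) (len q n i)) / n) atTop
      (𝓝 (lam q fun k => ∫ y, cylEnt (disint μ y) k ∂μ.map projY)) := by
    rw [Pmu_map_projY]
    refine ae_Pmu_of_ae q _ ?_ ?_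
    · exact measurableSet_tendsto _ fun n => (Finset.measurable_sum _ fun i _ =>
        (measurable_cylEnt_kernel (disint μ) _).comp (measurable_sect q i)).div_const _
    · filter_upwards [ae_tendsto_sum_cylEnt (disint μ) hq (μ.map projY)] with η hη
      refine hη.congr fun n => ?_
      congr 1
      exact Finset.sum_congr rfl fun i hi => by rw [sect_assemble hq η (mem_idx.1 hi).2]
  filter_upwards [h, disint_Pmu hq μ] with y hy hd
  refine hy.congr fun n => ?_
  rw [entropyRate_eq, hd, cylEnt_prodLaw hq]

/-- Almost every conditional measure lives on a fibre of the projection, and has the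
Shannon-McMillan-Breiman property with a constant that does not depend on the fibre. -/
theorem ae_tendsto_info_disint (hq : 2 ≤ q) :
    ∀ᵐ y ∂(Pmu q μ).map projY, (∀ᵐ z ∂disint (Pmu q μ) y, projY z = y) ∧
      ∀ᵐ z ∂disint (Pmu q μ) y, Tendsto (fun n : ℕ => info (disint (Pmu q μ) y) n z / n) atTop
        (𝓝 (lam q fun k => ∫ y, cylEnt (disint μ y) k ∂μ.map projY)) := by
  have h : ∀ᵐ z ∂Pmu q μ, Tendsto (fun n : ℕ =>
      (∑ i ∈ idx q n, info (disint μ (sect q (projY z) i)) (len q n i) (sect q z i)) / n) atTop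
      (𝓝 (lam q fun k => ∫ y, cylEnt (disint μ y) k ∂μ.map projY)) := by
    refine ae_Pmu_of_ae q _ ?_ ?_
    · exact measurableSet_tendsto _ fun n => (Finset.measurable_sum _ fun i _ =>
        (measurable_info_kernel (disint μ) _).comp
          (((measurable_sect q i).comp measurable_projY).prodMk (measurable_sect q i))).div_const _
    · filter_upwards [ae_tendsto_sum_info (disint μ) hq μ measurable_projY (compProd_disint μ)]
        with ω hω
      refine hω.congr fun n => ?_
      congr 1
      refine Finset.sum_congr rfl fun i hi => ?_
      rw [← projY_sect, sect_assemble hq ω (mem_idx.1 hi).2]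
  have h' := ae_disint_of_ae (Pmu q μ) (p := fun y z => Tendsto (fun n : ℕ =>
      (∑ i ∈ idx q n, info (disint μ (sect q y i)) (len q n i) (sect q z i)) / n) atTop
      (𝓝 (lam q fun k => ∫ y, cylEnt (disint μ y) k ∂μ.map projY)))
    (h.mono fun z hz y hy => by rwa [← hy])
  filter_upwards [h', disint_Pmu hq μ] with y hy hd
  refine ⟨hy.mono fun z hz => hz.1, ?_⟩
  filter_upwards [hy, ae_cyl_pos (disint (Pmu q μ) y)] with z hz hpos
  refine hz.2.congr fun n => ?_
  rw [hd] at hpos ⊢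
  rw [info_prodLaw hq _ (hpos n)]

/-- The inequality between the limits, and its equality case. -/
theorem lam_cylEnt_add_le (hq : 2 ≤ q) :
    lam q (cylEnt (μ.map projY)) + lam q (fun k => ∫ y, cylEnt (disint μ y) k ∂μ.map projY) ≤
        lam q (cylEnt μ) ∧
      (lam q (cylEnt (μ.map projY)) + lam q (fun k => ∫ y, cylEnt (disint μ y) k ∂μ.map projY) =
          lam q (cylEnt μ) ↔
        ∀ k, 1 ≤ k → ∀ u : Fin k → Fin m₁ × Fin m₂, ∃ c : ℝ, ∀ᵐ y ∂μ.map projY,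
          y ∈ cyl (fun j => (u j).2) → (disint μ y).real (cyl u) = c) := by
  have hτ := abs_cylEnt_le (μ.map projY)
  have hκ := abs_integral_cylEnt_le (disint μ) (μ.map projY)
  have hμ := abs_cylEnt_le μ
  have hpos : ∀ k : ℕ, (0 : ℝ) ≤ ((k : ℝ) + 1) ^ 4 := fun k => by positivity
  have hB := one_le_entBound (Fin m₂)
  have hB' := one_le_entBound (Fin m₁ × Fin m₂)
  have h1 : ∀ k : ℕ, |cylEnt (μ.map projY) k + ∫ y, cylEnt (disint μ y) k ∂μ.map projY| ≤
      (entBound (Fin m₂) + entBound (Fin m₁ × Fin m₂)) * ((k : ℝ) + 1) ^ 4 := fun k => by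
    rw [add_mul]
    exact (abs_add_le _ _).trans (add_le_add (hτ k) (hκ k))
  have h2 : ∀ k : ℕ, |cylEnt μ k| ≤
      (entBound (Fin m₂) + entBound (Fin m₁ × Fin m₂)) * ((k : ℝ) + 1) ^ 4 := fun k =>
    (hμ k).trans (mul_le_mul_of_nonneg_right (by linarith) (hpos k))
  rw [← lam_add hq hτ hκ]
  refine ⟨lam_mono hq h1 h2 fun k => (cylEnt_add_integral_le μ k).1, ?_⟩
  rw [lam_eq_iff hq h1 h2 fun k => (cylEnt_add_integral_le μ k).1]
  exact forall_congr' fun k => imp_congr_right fun _ => (cylEnt_add_integral_le μ k).2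

/-- Words that are not prefixes of elements of the support are irrelevant for the equality case,
and elements outside of the support are negligible. -/
theorem forall_pref_iff {Ω : Set (ℕ → Fin m₁ × Fin m₂)} (hΩ : MeasurableSet Ω) (hμ : μ Ωᶜ = 0)
    (k : ℕ) :
    (∀ u ∈ Pref k Ω, ∃ c, ∀ᵐ y ∂μ.map projY,
        y ∈ projY '' cyl u → disint μ y (Ω ∩ cyl u) = c) ↔
      ∀ u : Fin k → Fin m₁ × Fin m₂, ∃ c : ℝ, ∀ᵐ y ∂μ.map projY,
        y ∈ cyl (fun j => (u j).2) → (disint μ y).real (cyl u) = c := by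
  have hfull : ∀ᵐ y ∂μ.map projY, disint μ y Ωᶜ = 0 := by
    have h := setLIntegral_disint μ MeasurableSet.univ hΩ.compl
    rw [Set.preimage_univ, Set.univ_inter, hμ, Measure.restrict_univ] at h
    exact (lintegral_eq_zero_iff ((disint μ).measurable_coe hΩ.compl)).1 h
  have hinter : ∀ᵐ y ∂μ.map projY, ∀ u : Fin k → Fin m₁ × Fin m₂,
      disint μ y (Ω ∩ cyl u) = disint μ y (cyl u) := by
    filter_upwards [hfull] with y hy u
    rw [Set.inter_comm]
    exact measure_inter_conull hy
  constructor
  · intro h u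
    by_cases hu : u ∈ Pref k Ω
    · obtain ⟨c, hc⟩ := h u hu
      refine ⟨c.toReal, ?_⟩
      filter_upwards [hc, hinter] with y hy hy' hyu
      rw [← projY_image_cyl] at hyu
      rw [Measure.real, ← hy' u, hy hyu]
    · refine ⟨0, ?_⟩
      filter_upwards [hinter] with y hy _
      have : Ω ∩ cyl u = ∅ := Set.not_nonempty_iff_eq_empty.1 hu
      rw [Measure.real, ← hy u, this, measure_empty, ENNReal.toReal_zero]
  · intro h u _
    obtain ⟨c, hc⟩ := h u
    refine ⟨ENNReal.ofReal c, ?_⟩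
    filter_upwards [hc, hinter] with y hy hy' hyu
    rw [projY_image_cyl] at hyu
    rw [hy' u, ← hy hyu, ofReal_measureReal]

end

/-- Ledrappier–Young inequality for the measures `ℙ_μ`. -/
theorem mainTheorem2 (m₁ m₂ q : ℕ) [NeZero m₁] [NeZero m₂]
    (hm₂ : 2 ≤ m₂) (hm : m₂ ≤ m₁) (hq : 2 ≤ q)
    (Ω : Set (ℕ → Fin m₁ × Fin m₂)) (hΩ : IsClosed Ω)
    (μ : Measure (ℕ → Fin m₁ × Fin m₂)) [IsProbabilityMeasure μ] (hμ : μ Ωᶜ = 0) :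
    -- the projection of `ℙ_μ` and almost every conditional measure are exact dimensional
    IsExactDimensional (distY m₁ m₂) ((Pmu q μ).map projY) ∧
    (∀ᵐ y ∂(Pmu q μ).map projY, IsExactDimensional (distXY m₁ m₂) (disint (Pmu q μ) y)) ∧
    -- the entropy dimensions exist, and that of the conditional measure is almost surely constant
    (∃ δ, HasEntropyDim (Pmu q μ) δ) ∧
    (∃ δ, HasEntropyDim ((Pmu q μ).map projY) δ) ∧
    (∀ᵐ y ∂(Pmu q μ).map projY, HasEntropyDim (disint (Pmu q μ) y)
      (essInf (fun y => dimE (disint (Pmu q μ) y)) ((Pmu q μ).map projY))) ∧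
    essInf (fun y => dimE (disint (Pmu q μ) y)) ((Pmu q μ).map projY) =
      essSup (fun y => dimE (disint (Pmu q μ) y)) ((Pmu q μ).map projY) ∧
    -- the inequality
    dimE ((Pmu q μ).map projY) +
        essInf (fun y => dimE (disint (Pmu q μ) y)) ((Pmu q μ).map projY) ≤ dimE (Pmu q μ) ∧
    -- the case of equality
    (dimE ((Pmu q μ).map projY) +
        essInf (fun y => dimE (disint (Pmu q μ) y)) ((Pmu q μ).map projY) = dimE (Pmu q μ) ↔
      ∀ p : ℕ, 1 ≤ p → ∀ u ∈ Pref p Ω, ∃ c, ∀ᵐ y ∂μ.map projY,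
        y ∈ projY '' cyl u → disint μ y (Ω ∩ cyl u) = c) := by
  have hm₁ : 2 ≤ m₁ := hm₂.trans hm
  have hconst := ae_hasEntropyDim_disint μ hq
  have hdim : (fun y => dimE (disint (Pmu q μ) y)) =ᵐ[(Pmu q μ).map projY]
      fun _ => lam q fun k => ∫ y, cylEnt (disint μ y) k ∂μ.map projY :=
    hconst.mono fun y hy => hy.dimE_eq
  have hinf : essInf (fun y => dimE (disint (Pmu q μ) y)) ((Pmu q μ).map projY) =
      lam q fun k => ∫ y, cylEnt (disint μ y) k ∂μ.map projY :=
    (essInf_congr_ae hdim).trans (essInf_const _ (IsProbabilityMeasure.ne_zero _))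
  have hsup : essSup (fun y => dimE (disint (Pmu q μ) y)) ((Pmu q μ).map projY) =
      lam q fun k => ∫ y, cylEnt (disint μ y) k ∂μ.map projY :=
    (essSup_congr_ae hdim).trans (essSup_const _ (IsProbabilityMeasure.ne_zero _))
  have hP := hasEntropyDim_Pmu μ hq
  have hπP : HasEntropyDim ((Pmu q μ).map projY) (lam q (cylEnt (μ.map projY))) := by
    rw [Pmu_map_projY]
    exact hasEntropyDim_Pmu (μ.map projY) hq
  have hle := lam_cylEnt_add_le μ hq
  rw [hinf, hsup, hP.dimE_eq, hπP.dimE_eq]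
  refine ⟨?_, ?_, ⟨_, hP⟩, ⟨_, hπP⟩, hconst, rfl, hle.1, ?_⟩
  · refine isExactDimensional_distY hm₁ hm₂ (h := lam q (cylEnt (μ.map projY))) ?_
    rw [Pmu_map_projY]
    exact ae_tendsto_info_Pmu (μ.map projY) hq
  · filter_upwards [ae_tendsto_info_disint μ hq] with y hy
    exact isExactDimensional_distXY hm₁ hm₂ hy.1 hy.2
  · rw [hle.2]
    exact forall_congr' fun k => imp_congr_right fun _ =>
      (forall_pref_iff μ hΩ.measurableSet hμ k).symm
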